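/- Let $\Bbbk$ be an algebraically closed field of characteristic zero; a variety is an integral scheme, separated and of finite type over $\Bbbk$. Let $\pi:C\to S$ be an affine cone of varieties, i.e. $\pi$ is an affine morphism of varieties together with a grading $\pi_*\mathcal O_C=\bigoplus_{n\ge 0}\mathcal A_n$ of the quasi-coherent $\mathcal O_S$-algebra $\pi_*\mathcal O_C$ with $\mathcal A_0=\mathcal O_S$; equivalently, $C$ carries a $\mathbb G_m$-action over $S$ for which $f(t.x)=t^nf(x)$ when $f\in\mathcal A_n$. Let $Z=\mathbb V(\bigoplus_{n>0}\mathcal A_n)\subseteq C$ be the zero section, so that $\pi|_Z:Z\to S$ is an isomorphism. Let $r,w\ge 1$ and let $\mathbb G_a^r$ act on $C$ such that $\pi$ is $\mathbb G_a^r$-invariant and the actions of $\mathbb G_a^r$ and $\mathbb G_m$ form an action of $\mathbb G_a^r\rtimes_w\mathbb G_m$, i.e. $t.(u.x)=(t^wu).(t.x)$. Let $\mathfrak u=\Bbbk^r$ be the Lie algebra of $\mathbb G_a^r$ and, for a $\Bbbk$-point $x$ of $C$, let $\mathrm{Stab}_{\mathfrak u}(x)\subseteq\mathfrak u$ be the Lie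 algebra of the stabiliser of $x$. Put $d(\pi)=\min_{z\in Z(\Bbbk)}\dim\mathrm{Stab}_{\mathfrak u}(z)$ and assume that $\dim\mathrm{Stab}_{\mathfrak u}(z)=d(\pi)$ for all $z\in Z(\Bbbk)$. Then the image of $\mathbb G_a^r\times Z\to C$, $(u,z)\mapsto u.z$, is closed. Moreover, every point of $S$ has an affine open neighbourhood $V$ for which there is a linear subspace $\mathfrak v\subseteq\mathfrak u$ with the following properties. Write $C_V=\pi^{-1}(V)$ and $Z_V=Z\cap C_V$, and let $U'\subseteq\mathbb G_a^r$ be the subgroup with Lie algebra $\mathfrak v$. 1. $\mathfrak u=\mathfrak v\oplus\mathrm{Stab}_{\mathfrak u}(z)$ for all $z\in Z_V(\Bbbk)$. 2. $U'$ acts freely on $C_V$, i.e. for every scheme $T$, an element of $U'(T)$ that fixes a point of $C_V(T)$ is trivial. 3. The images of $\mathbb G_a^r\times Z_V\to C_V$ and of $U'\times Z_V\to C_V$ are the same set, and this set is the underlying set of the scheme-theoretic image of $U'\times Z_V\to C_V$. 4. The scheme-theoretic images of $\mathbb G_a^r\times Z_V\to C_V$ and $U'\times Z_V\to C_V$ are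 the same closed subscheme of $C_V$. -/

import Mathlib

open CategoryTheory AlgebraicGeometry

universe u

noncomputable section

namespace GradedAdditive

/-! ### Morphisms into a scheme that is affine over the base -/

lemma affine_preimage {C S : Scheme.{u}} (π : C ⟶ S) [IsAffineHom π] (U : S.affineOpens) :
    IsAffineOpen (π ⁻¹ᵁ U.1) := IsAffineOpen.preimage (U := U.1) U.2 π

section Relative

variable {C S T : Scheme.{u}} (π : C ⟶ S) [IsAffineHom π] (q : T ⟶ S)
  (φ : ∀ U : S.affineOpens, Γ(C, π ⁻¹ᵁ U.1) ⟶ Γ(T, q ⁻¹ᵁ U.1))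

/-- The morphism `q⁻¹ U ⟶ C` induced by a ring homomorphism `Γ(C, π⁻¹ U) → Γ(T, q⁻¹ U)`. -/
def relPiece (U : S.affineOpens) : (q ⁻¹ᵁ U.1).toScheme ⟶ C :=
  (q ⁻¹ᵁ U.1).toSpecΓ ≫ Spec.map (φ U) ≫ (affine_preimage π U).fromSpec

/-- Compatibility of a family of ring homomorphisms with restriction. -/
def RelCompat : Prop := ∀ (U V : S.affineOpens) (h : U ≤ V),
  C.presheaf.map (homOfLE (π.preimage_mono h)).op ≫ φ U =
    φ V ≫ T.presheaf.map (homOfLE (q.preimage_mono h)).op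

variable {φ}

lemma homOfLE_relPiece (hφ : RelCompat π q φ) (U V : S.affineOpens) (h : U ≤ V) :
    T.homOfLE (q.preimage_mono h) ≫ relPiece π q φ V = relPiece π q φ U := by
  unfold relPiece
  rw [← Scheme.Opens.toSpecΓ_SpecMap_presheaf_map_assoc, ← Spec.map_comp_assoc, ← hφ U V h,
    Spec.map_comp_assoc, IsAffineOpen.map_fromSpec]

lemma exists_relHom (hφ : RelCompat π q φ) :
    ∃ f : T ⟶ C, ∀ U : S.affineOpens, (q ⁻¹ᵁ U.1).ι ≫ f = relPiece π q φ U := by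
  let 𝒰 : T.OpenCover := T.openCoverOfIsOpenCover (fun U : S.affineOpens ↦ q ⁻¹ᵁ U.1)
    (.comap (iSup_affineOpens_eq_top S) q.base.1)
  refine ⟨𝒰.glueMorphisms (relPiece π q φ) ?_, fun U ↦ 𝒰.ι_glueMorphisms _ _ U⟩
  intro (U : S.affineOpens) (V : S.affineOpens)
  change Limits.pullback.fst (q ⁻¹ᵁ U.1).ι (q ⁻¹ᵁ V.1).ι ≫ _ =
    Limits.pullback.snd (q ⁻¹ᵁ U.1).ι (q ⁻¹ᵁ V.1).ι ≫ _
  have hc := Limits.pullback.condition (f := (q ⁻¹ᵁ U.1).ι) (g := (q ⁻¹ᵁ V.1).ι)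
  generalize Limits.pullback.fst (q ⁻¹ᵁ U.1).ι (q ⁻¹ᵁ V.1).ι = a at *
  generalize Limits.pullback.snd (q ⁻¹ᵁ U.1).ι (q ⁻¹ᵁ V.1).ι = b at *
  refine Scheme.hom_ext_of_forall _ _ fun x ↦ ?_
  have hx : q ((a ≫ (q ⁻¹ᵁ U.1).ι) x) ∈ U.1 ⊓ V.1 :=
    ⟨(a x).2, by rw [hc]; exact (b x).2⟩
  obtain ⟨_, ⟨W, hW, rfl⟩, hxW, hle⟩ := S.isBasis_affineOpens.exists_subset_of_mem_open hx
    (U.1 ⊓ V.1).2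
  have hWU : (⟨W, hW⟩ : S.affineOpens) ≤ U := fun y hy ↦ (hle hy).1
  have hWV : (⟨W, hW⟩ : S.affineOpens) ≤ V := fun y hy ↦ (hle hy).2
  refine ⟨(a ≫ (q ⁻¹ᵁ U.1).ι) ⁻¹ᵁ (q ⁻¹ᵁ W), hxW, ?_⟩
  set g := a ≫ (q ⁻¹ᵁ U.1).ι with hg
  set O := g ⁻¹ᵁ (q ⁻¹ᵁ W)
  have h1 : O.ι ≫ a = g.resLE (q ⁻¹ᵁ W) O le_rfl ≫ T.homOfLE (q.preimage_mono hWU) := by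
    rw [← cancel_mono (q ⁻¹ᵁ U.1).ι]
    simp [hg]
  have h2 : O.ι ≫ b = g.resLE (q ⁻¹ᵁ W) O le_rfl ≫ T.homOfLE (q.preimage_mono hWV) := by
    rw [← cancel_mono (q ⁻¹ᵁ V.1).ι]
    simp [hc]
  rw [reassoc_of% h1, reassoc_of% h2, homOfLE_relPiece π q hφ ⟨W, hW⟩ U hWU,
    homOfLE_relPiece π q hφ ⟨W, hW⟩ V hWV]

/-- If `C` is affine over `S`, a family of ring homomorphisms `Γ(C, π⁻¹ U) → Γ(T, q⁻¹ U)`,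
`U ⊆ S` affine open, that is compatible with restriction glues to a morphism `T ⟶ C`. -/
def relHom (hφ : RelCompat π q φ) : T ⟶ C := (exists_relHom π q hφ).choose

lemma ι_relHom (hφ : RelCompat π q φ) (U : S.affineOpens) :
    (q ⁻¹ᵁ U.1).ι ≫ relHom π q hφ = relPiece π q φ U :=
  (exists_relHom π q hφ).choose_spec U

/-- The glued morphism is an `S`-morphism as soon as the ring homomorphisms are
`Γ(S, U)`-linear. -/
lemma relHom_comp (hφ : RelCompat π q φ)
    (hq : ∀ U : S.affineOpens, π.app U.1 ≫ φ U = q.app U.1) : relHom π q hφ ≫ π = q := by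
  refine Scheme.Cover.hom_ext (T.openCoverOfIsOpenCover (fun U : S.affineOpens ↦ q ⁻¹ᵁ U.1)
    (.comap (iSup_affineOpens_eq_top S) q.base.1)) _ _ fun (U : S.affineOpens) ↦ ?_
  change (q ⁻¹ᵁ U.1).ι ≫ _ = (q ⁻¹ᵁ U.1).ι ≫ _
  have hU : IsAffineOpen U.1 := U.2
  have h : (affine_preimage π U).fromSpec ≫ π = Spec.map (π.app U.1) ≫ hU.fromSpec := by
    rw [Scheme.Hom.app_eq_appLE, IsAffineOpen.SpecMap_appLE_fromSpec]
  rw [← Category.assoc, ι_relHom]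
  simp only [relPiece, Category.assoc]
  rw [h, ← Spec.map_comp_assoc, hq, Scheme.Opens.toSpecΓ_naturality_assoc,
    IsAffineOpen.toSpecΓ_fromSpec, morphismRestrict_ι]

/-- The glued morphism induces the given ring homomorphisms. -/
lemma relHom_appLE (hφ : RelCompat π q φ) (U : S.affineOpens)
    (e : q ⁻¹ᵁ U.1 ≤ relHom π q hφ ⁻¹ᵁ (π ⁻¹ᵁ U.1)) :
    (relHom π q hφ).appLE (π ⁻¹ᵁ U.1) (q ⁻¹ᵁ U.1) e = φ U := by
  have h1 := Scheme.Opens.toSpecΓ_SpecMap_appLE (relHom π q hφ) (π ⁻¹ᵁ U.1) (q ⁻¹ᵁ U.1) e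
  have h2 : (q ⁻¹ᵁ U.1).toSpecΓ ≫ Spec.map ((relHom π q hφ).appLE _ _ e) =
      (q ⁻¹ᵁ U.1).toSpecΓ ≫ Spec.map (φ U) := by
    rw [h1, ← cancel_mono (affine_preimage π U).fromSpec]
    have := ι_relHom π q hφ U
    simp only [relPiece] at this
    simp [this]
  have h3 := congr(($h2).appTop)
  simp only [Scheme.Hom.comp_appTop, Scheme.Opens.toSpecΓ_appTop] at h3
  have h4 := Scheme.ΓSpecIso_naturality ((relHom π q hφ).appLE _ _ e)
  have h5 := Scheme.ΓSpecIso_naturality (φ U)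
  rw [reassoc_of% h4, reassoc_of% h5] at h3
  have h6 := (cancel_epi _).1 h3
  exact (cancel_mono _).1 h6

end Relative

/-! ### Affine cones -/

section Graded

variable {A B : Type u} [CommRing A] [CommRing B] (𝒜 : ℕ → AddSubgroup A) [GradedRing 𝒜]

/-- For a graded ring `A`, a ring homomorphism `ψ : A → B` and `t ∈ B`, the ring homomorphism
`A → B` given by `f ↦ t ^ n * ψ f` for `f` of degree `n`. -/
def twist (ψ : A →+* B) (t : B) : A →+* B :=
  (DirectSum.toSemiring
    (fun n ↦ (AddMonoidHom.mulLeft (t ^ n)).comp (ψ.toAddMonoidHom.comp (𝒜 n).subtype))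
    (by change t ^ 0 * ψ 1 = 1; simp) (by
      intro i j a b
      change t ^ (i + j) * ψ (a * b) = (t ^ i * ψ a) * (t ^ j * ψ b)
      rw [map_mul, pow_add]; ring)).comp (DirectSum.decomposeRingEquiv 𝒜).toRingHom

lemma twist_of_mem (ψ : A →+* B) (t : B) {n : ℕ} {f : A} (hf : f ∈ 𝒜 n) :
    twist 𝒜 ψ t f = t ^ n * ψ f := by
  simp only [twist, RingHom.comp_apply]
  change DirectSum.toSemiring _ _ _ (DirectSum.decompose 𝒜 f) = _
  rw [DirectSum.decompose_of_mem _ hf]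
  simp

lemma graded_hom_ext {f g : A →+* B} (h : ∀ n, ∀ a ∈ 𝒜 n, f a = g a) : f = g := by
  ext a
  induction a using DirectSum.Decomposition.inductionOn 𝒜 with
  | zero => simp
  | homogeneous a => exact h _ _ a.2
  | add a b ha hb => simp [ha, hb]

end Graded

/-- The structure of an affine cone on an affine morphism `π : C ⟶ S`: an `ℕ`-grading
`π_* 𝒪_C = ⨁ 𝒜_n` of the quasi-coherent `𝒪_S`-algebra `π_* 𝒪_C`, given by its sections
`𝒜_n(U)` over the affine open sets `U ⊆ S`, such that `𝒪_S → 𝒜_0` is an isomorphism. -/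
structure ConeGrading {C S : Scheme.{u}} (π : C ⟶ S) where
  /-- the sections of `𝒜_n` over `U` -/
  piece (U : S.affineOpens) : ℕ → AddSubgroup Γ(C, π ⁻¹ᵁ U.1)
  gradedRing (U : S.affineOpens) : GradedRing (piece U)
  map_mem (U V : S.affineOpens) (h : U ≤ V) (n : ℕ) (f : Γ(C, π ⁻¹ᵁ V.1)) (hf : f ∈ piece V n) :
    C.presheaf.map (homOfLE (π.preimage_mono h)).op f ∈ piece U n
  injective (U : S.affineOpens) : Function.Injective (π.app U.1)
  piece_zero (U : S.affineOpens) : (piece U 0 : Set Γ(C, π ⁻¹ᵁ U.1)) = Set.range (π.app U.1)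

attribute [instance] ConeGrading.gradedRing

namespace ConeGrading

variable {C S : Scheme.{u}} {π : C ⟶ S} (G : ConeGrading π)

lemma app_mem_zero (U : S.affineOpens) (g : Γ(S, U.1)) : π.app U.1 g ∈ G.piece U 0 := by
  have : π.app U.1 g ∈ (G.piece U 0 : Set _) := by rw [G.piece_zero]; exact ⟨g, rfl⟩
  exact this

lemma rangeRestrict_bijective (G : ConeGrading π) (U : S.affineOpens) :
    Function.Bijective (π.app U.1).hom.rangeRestrict :=
  have h := G.injective U
  ⟨fun _ _ e ↦ h (congrArg Subtype.val e), RingHom.rangeRestrict_surjective _⟩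

lemma projZero_mem (U : S.affineOpens) (f : Γ(C, π ⁻¹ᵁ U.1)) :
    GradedRing.projZeroRingHom (G.piece U) f ∈ (π.app U.1).hom.range := by
  have : GradedRing.projZeroRingHom (G.piece U) f ∈ (G.piece U 0 : Set _) :=
    (DirectSum.decompose (G.piece U) f 0).2
  rw [G.piece_zero] at this
  exact this

/-- The projection `⨁ 𝒜_n(U) → 𝒜_0(U) = Γ(S, U)`. -/
def zeroRing (U : S.affineOpens) : Γ(C, π ⁻¹ᵁ U.1) →+* Γ(S, U.1) :=
  (RingEquiv.ofBijective _ (G.rangeRestrict_bijective U)).symm.toRingHom.comp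
    ((GradedRing.projZeroRingHom (G.piece U)).codRestrict _ (G.projZero_mem U))

lemma app_zeroRing (U : S.affineOpens) (f : Γ(C, π ⁻¹ᵁ U.1)) :
    π.app U.1 (G.zeroRing U f) = GradedRing.projZeroRingHom (G.piece U) f :=
  congrArg Subtype.val (RingEquiv.apply_symm_apply
    (RingEquiv.ofBijective _ (G.rangeRestrict_bijective U)) ⟨_, G.projZero_mem U f⟩)

lemma zeroRing_app (U : S.affineOpens) (g : Γ(S, U.1)) : G.zeroRing U (π.app U.1 g) = g := by
  apply G.injective U
  rw [app_zeroRing]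
  exact DirectSum.decompose_of_mem_same _ (G.app_mem_zero U g)

lemma zeroRing_of_mem (U : S.affineOpens) {n : ℕ} (hn : 0 < n) {f : Γ(C, π ⁻¹ᵁ U.1)}
    (hf : f ∈ G.piece U n) : G.zeroRing U f = 0 := by
  apply G.injective U
  rw [app_zeroRing, map_zero]
  exact DirectSum.decompose_of_mem_ne _ hf hn.ne'

lemma zero_compat : RelCompat π (𝟙 S)
    (fun U ↦ CommRingCat.ofHom (G.zeroRing U) ≫ (𝟙 S : S ⟶ S).app U.1) := by
  intro U V h
  have key : (G.zeroRing U).comp (C.presheaf.map (homOfLE (π.preimage_mono h)).op).hom =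
      (S.presheaf.map (homOfLE h).op).hom.comp (G.zeroRing V) := by
    refine graded_hom_ext (G.piece V) fun n f hf ↦ ?_
    simp only [RingHom.comp_apply]
    rcases n.eq_zero_or_pos with rfl | hn
    · have hf' : f ∈ (G.piece V 0 : Set _) := hf
      rw [G.piece_zero] at hf'
      obtain ⟨g, rfl⟩ := hf'
      have := congr(($(π.naturality (homOfLE h).op)).hom g)
      rw [G.zeroRing_app]
      refine Eq.trans ?_ (G.zeroRing_app U _)
      exact congrArg (G.zeroRing U) this.symm
    · rw [G.zeroRing_of_mem V hn hf, map_zero]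
      exact G.zeroRing_of_mem U hn (G.map_mem U V h n f hf)
  have key' : C.presheaf.map (homOfLE (π.preimage_mono h)).op ≫ CommRingCat.ofHom (G.zeroRing U) =
      CommRingCat.ofHom (G.zeroRing V) ≫ S.presheaf.map (homOfLE h).op :=
    CommRingCat.hom_ext key
  rw [reassoc_of% key', Category.assoc]
  congr 1

lemma gm_compat {T : Scheme.{u}} (t : Γ(T, ⊤)) (x : T ⟶ C) : RelCompat π (x ≫ π)
    (fun U ↦ CommRingCat.ofHom (twist (G.piece U)
      (x.appLE (π ⁻¹ᵁ U.1) ((x ≫ π) ⁻¹ᵁ U.1) le_rfl).hom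
      (T.presheaf.map (homOfLE le_top).op t))) := by
  intro U V h
  refine CommRingCat.hom_ext (graded_hom_ext (G.piece V) fun n f hf ↦ ?_)
  simp only [CommRingCat.hom_comp, RingHom.comp_apply, CommRingCat.hom_ofHom]
  rw [twist_of_mem _ _ _ hf]
  refine (twist_of_mem (G.piece U) _ _ (G.map_mem U V h n f hf)).trans ?_
  rw [map_mul, map_pow]
  congr 1
  · congr 1
    have := T.presheaf.map_comp (homOfLE (le_top : (x ≫ π) ⁻¹ᵁ V.1 ≤ ⊤)).op
      (homOfLE ((x ≫ π).preimage_mono h)).op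
    exact congr(($this).hom t)
  · have h1 := x.map_appLE (U := π ⁻¹ᵁ U.1) (U' := π ⁻¹ᵁ V.1) (V := (x ≫ π) ⁻¹ᵁ U.1) le_rfl
      (homOfLE (π.preimage_mono h)).op
    have h2 := x.appLE_map (U := π ⁻¹ᵁ V.1) (V := (x ≫ π) ⁻¹ᵁ V.1) (V' := (x ≫ π) ⁻¹ᵁ U.1) le_rfl
      (homOfLE ((x ≫ π).preimage_mono h)).op
    exact congr(($(h1.trans h2.symm)).hom f)

variable [IsAffineHom π]

/-- The zero section `S ⟶ C`: the embedding of the closed subscheme `Z = 𝕍(⨁_{n > 0} 𝒜_n)`,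
identified with `S` through `π`. Over `U ⊆ S` affine open it is the projection
`⨁ 𝒜_n(U) → 𝒜_0(U) = Γ(S, U)`. -/
def zeroSection : S ⟶ C := relHom π (𝟙 S) G.zero_compat

lemma zeroSection_comp : G.zeroSection ≫ π = 𝟙 S :=
  relHom_comp π (𝟙 S) G.zero_compat fun U ↦ by
    rw [← Category.assoc]
    have : π.app U.1 ≫ CommRingCat.ofHom (G.zeroRing U) = 𝟙 _ :=
      CommRingCat.hom_ext (RingHom.ext fun g ↦ G.zeroRing_app U g)
    rw [this, Category.id_comp]

/-- Over `π⁻¹ U` the zero section is cut out by the ideal `⨁_{n > 0} 𝒜_n(U)`. -/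
lemma zeroSection_ker (U : S.affineOpens) (e : U.1 ≤ G.zeroSection ⁻¹ᵁ (π ⁻¹ᵁ U.1))
    (f : Γ(C, π ⁻¹ᵁ U.1)) : G.zeroSection.appLE (π ⁻¹ᵁ U.1) U.1 e f = 0 ↔
      f ∈ HomogeneousIdeal.irrelevant (G.piece U) := by
  have h : G.zeroSection.appLE (π ⁻¹ᵁ U.1) U.1 e = CommRingCat.ofHom (G.zeroRing U) := by
    have := relHom_appLE π (𝟙 S) G.zero_compat U e
    refine Eq.trans this ?_
    simp only [Scheme.Hom.id_app]
    exact Category.comp_id _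
  rw [h, HomogeneousIdeal.mem_irrelevant_iff]
  change G.zeroRing U f = 0 ↔ GradedRing.projZeroRingHom (G.piece U) f = 0
  rw [← G.app_zeroRing, map_eq_zero_iff _ (G.injective U)]

/-- The `𝔾_m`-action on the affine cone `C`, on `T`-valued points: for `t ∈ 𝔾_m(T) = Γ(T, ⊤)ˣ`
and `x ∈ C(T)`, the point `t.x` lies over the same point of `S` as `x`, and
`f (t.x) = t ^ n * f x` for `f ∈ 𝒜_n`. -/
def gm {T : Scheme.{u}} (t : Γ(T, ⊤)ˣ) (x : T ⟶ C) : T ⟶ C :=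
  relHom π (x ≫ π) (G.gm_compat (t : Γ(T, ⊤)) x)

lemma gm_comp {T : Scheme.{u}} (t : Γ(T, ⊤)ˣ) (x : T ⟶ C) : G.gm t x ≫ π = x ≫ π :=
  relHom_comp π (x ≫ π) (G.gm_compat (t : Γ(T, ⊤)) x) fun U ↦ by
    refine CommRingCat.hom_ext (RingHom.ext fun g ↦ ?_)
    simp only [CommRingCat.hom_comp, RingHom.comp_apply, CommRingCat.hom_ofHom]
    refine (twist_of_mem (G.piece U) _ _ (G.app_mem_zero U g)).trans ?_
    rw [pow_zero, one_mul]
    rw [← Scheme.Hom.appLE_eq_app (x ≫ π), Scheme.Hom.comp_appLE]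
    rfl

lemma gm_appLE {T : Scheme.{u}} (t : Γ(T, ⊤)ˣ) (x : T ⟶ C) (U : S.affineOpens)
    (e : (x ≫ π) ⁻¹ᵁ U.1 ≤ G.gm t x ⁻¹ᵁ (π ⁻¹ᵁ U.1)) (n : ℕ) (f : Γ(C, π ⁻¹ᵁ U.1))
    (hf : f ∈ G.piece U n) :
    (G.gm t x).appLE (π ⁻¹ᵁ U.1) ((x ≫ π) ⁻¹ᵁ U.1) e f =
      T.presheaf.map (homOfLE le_top).op (t : Γ(T, ⊤)) ^ n *
        x.appLE (π ⁻¹ᵁ U.1) ((x ≫ π) ⁻¹ᵁ U.1) le_rfl f := by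
  have := relHom_appLE π (x ≫ π) (G.gm_compat (t : Γ(T, ⊤)) x) U e
  exact congr(($this).hom f).trans (twist_of_mem (G.piece U) _ _ hf)

end ConeGrading

/-! ### Actions of `𝔾_a^r` -/

/-- The structure homomorphism `k → Γ(X, ⊤)` of a `k`-scheme `X`. -/
def scalar {k : Type u} [Field k] {X : Scheme.{u}} (p : X ⟶ Spec (.of k)) : k →+* Γ(X, ⊤) :=
  ((Scheme.ΓSpecIso (.of k)).inv ≫ p.appTop).hom

/-- An action of `𝔾_a^ι` (`ι` finite; `𝔾_a^r` for `r = |ι|`) on the `k`-scheme `p : C ⟶ Spec k`.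
The product `𝔾_a^ι ×_k C` is the affine space `𝔸(ι; C)`, whose `T`-valued points are pairs of
`u ∈ 𝔾_a^ι(T) = Γ(T, ⊤) ^ ι` and `x ∈ C(T)`; the axioms of an action are stated on
`T`-valued points. -/
structure GaAction {k : Type u} [Field k] (ι : Type u) {C : Scheme.{u}}
    (p : C ⟶ Spec (.of k)) where
  /-- the action morphism `𝔾_a^ι ×_k C ⟶ C` -/
  act : 𝔸(ι; C) ⟶ C
  act_over : act ≫ p = (𝔸(ι; C) ↘ C) ≫ p
  zero_act {T : Scheme.{u}} (x : T ⟶ C) : AffineSpace.homOfVector x 0 ≫ act = x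
  add_act {T : Scheme.{u}} (u v : ι → Γ(T, ⊤)) (x : T ⟶ C) :
    AffineSpace.homOfVector x (u + v) ≫ act =
      AffineSpace.homOfVector (AffineSpace.homOfVector x v ≫ act) u ≫ act

namespace GaAction

variable {k : Type u} [Field k] {ι : Type u} {C : Scheme.{u}} {p : C ⟶ Spec (.of k)}
  (σ : GaAction ι p)

/-- `u.x` for `u ∈ 𝔾_a^ι(T)` and `x ∈ C(T)`. -/
def smul {T : Scheme.{u}} (u : ι → Γ(T, ⊤)) (x : T ⟶ C) : T ⟶ C :=
  AffineSpace.homOfVector x u ≫ σ.act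

lemma zero_smul {T : Scheme.{u}} (x : T ⟶ C) : σ.smul 0 x = x := σ.zero_act x

lemma add_smul {T : Scheme.{u}} (u v : ι → Γ(T, ⊤)) (x : T ⟶ C) :
    σ.smul (u + v) x = σ.smul u (σ.smul v x) := σ.add_act u v x

lemma comp_smul {T T' : Scheme.{u}} (g : T' ⟶ T) (u : ι → Γ(T, ⊤)) (x : T ⟶ C) :
    g ≫ σ.smul u x = σ.smul (fun i ↦ g.appTop (u i)) (g ≫ x) := by
  rw [smul, ← Category.assoc, AffineSpace.comp_homOfVector]
  rfl

/-- The morphism `Spec k[ε] ⟶ Spec k`. -/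
def dualBase (k : Type u) [Field k] : Spec (.of (DualNumber k)) ⟶ Spec (.of k) :=
  Spec.map (CommRingCat.ofHom (algebraMap k (DualNumber k)))

/-- The element `ε ξ` of `𝔾_a^ι(k[ε])`, for `ξ` in the Lie algebra `𝔲 = k^ι` of `𝔾_a^ι`. -/
def dualVec (ξ : ι → k) : ι → Γ(Spec (.of (DualNumber k)), ⊤) :=
  fun i ↦ (Scheme.ΓSpecIso (.of (DualNumber k))).inv (TrivSqZeroExt.inr (ξ i) : DualNumber k)

lemma dualVec_zero : dualVec (0 : ι → k) = 0 := by
  funext i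
  change (Scheme.ΓSpecIso (.of (DualNumber k))).inv (TrivSqZeroExt.inr (0 : k) : DualNumber k) = 0
  rw [TrivSqZeroExt.inr_zero, map_zero]

lemma dualVec_add (ξ η : ι → k) : dualVec (ξ + η) = dualVec ξ + dualVec η := by
  funext i
  change (Scheme.ΓSpecIso (.of (DualNumber k))).inv
    (TrivSqZeroExt.inr (ξ i + η i) : DualNumber k) = _
  rw [TrivSqZeroExt.inr_add, map_add]
  rfl

/-- The `k`-algebra endomorphism `ε ↦ c ε` of `k[ε]`. -/
def dualScale (c : k) : DualNumber k →ₐ[k] DualNumber k :=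
  TrivSqZeroExt.map (c • LinearMap.id)

lemma dualScale_base (c : k) :
    Spec.map (CommRingCat.ofHom (dualScale c).toRingHom) ≫ dualBase k = dualBase k := by
  rw [dualBase, ← Spec.map_comp]
  congr 1
  exact CommRingCat.hom_ext (RingHom.ext fun a ↦ (dualScale c).commutes a)

lemma dualScale_dualVec (c : k) (ξ : ι → k) (i : ι) :
    (Spec.map (CommRingCat.ofHom (dualScale c).toRingHom)).appTop (dualVec ξ i) =
      dualVec (c • ξ) i := by
  have h := Scheme.ΓSpecIso_inv_naturality (CommRingCat.ofHom (dualScale c).toRingHom)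
  refine congr(($h).hom (TrivSqZeroExt.inr (ξ i) : DualNumber k)).symm.trans ?_
  change (Scheme.ΓSpecIso (.of (DualNumber k))).inv (dualScale c (TrivSqZeroExt.inr (ξ i))) = _
  rw [dualScale, TrivSqZeroExt.map_inr]
  rfl

/-- The Lie algebra stabiliser `Stab_𝔲(x) ⊆ 𝔲 = k^ι` of `x ∈ C(k)`, i.e. the Lie algebra of the
stabiliser group scheme of `x`: all `ξ` such that `ε ξ ∈ 𝔾_a^ι(k[ε])` fixes `x ∈ C(k[ε])`. -/
def stab (x : Spec (.of k) ⟶ C) : Submodule k (ι → k) where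
  carrier := {ξ | σ.smul (dualVec ξ) (dualBase k ≫ x) = dualBase k ≫ x}
  zero_mem' := by
    change σ.smul (dualVec 0) (dualBase k ≫ x) = dualBase k ≫ x
    rw [dualVec_zero, zero_smul]
  add_mem' {ξ η} hξ hη := by
    change σ.smul (dualVec (ξ + η)) (dualBase k ≫ x) = dualBase k ≫ x
    rw [dualVec_add, add_smul, show σ.smul (dualVec η) (dualBase k ≫ x) = _ from hη]
    exact hξ
  smul_mem' c ξ hξ := by
    have h : σ.smul (dualVec ξ) (dualBase k ≫ x) = dualBase k ≫ x := hξ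
    have h' := congr(Spec.map (CommRingCat.ofHom (dualScale c).toRingHom) ≫ $h)
    rw [comp_smul, ← Category.assoc, dualScale_base, funext (dualScale_dualVec c ξ)] at h'
    exact h'

/-- The morphism `𝔾_a^ι ×_k Z ⟶ C`, `(u, z) ↦ u.z`, for `i : Z ⟶ C`. -/
def sweep {Z : Scheme.{u}} (i : Z ⟶ C) : 𝔸(ι; Z) ⟶ C :=
  AffineSpace.map ι i ≫ σ.act

/-! Let `β` be a basis, indexed by `κ`, of a subspace `𝔳 ⊆ 𝔲 = k^ι`. The corresponding subgroup
`U' ⊆ 𝔾_a^ι` is the image of `𝔾_a^κ ↪ 𝔾_a^ι`, `c ↦ ∑ j, c_j β_j`. -/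

variable {κ : Type u} [Fintype κ]

/-- The point `∑ j, c_j β_j` of `U'(X) ⊆ 𝔾_a^ι(X)`, for `c_j ∈ Γ(X, ⊤)`. -/
def lin {X : Scheme.{u}} (q : X ⟶ Spec (.of k)) (β : κ → ι → k) (c : κ → Γ(X, ⊤)) :
    ι → Γ(X, ⊤) :=
  fun i ↦ ∑ j, scalar q (β j i) * c j

/-- The inclusion `U' ×_k X ⟶ 𝔾_a^ι ×_k X`. -/
def subgroupHom {X : Scheme.{u}} (q : X ⟶ Spec (.of k)) (β : κ → ι → k) : 𝔸(κ; X) ⟶ 𝔸(ι; X) :=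
  AffineSpace.homOfVector (𝔸(κ; X) ↘ X) (lin ((𝔸(κ; X) ↘ X) ≫ q) β (AffineSpace.coord X))

/-- The morphism `U' ×_k Z ⟶ C`, `(u, z) ↦ u.z`, for `i : Z ⟶ C`. -/
def subSweep (β : κ → ι → k) {Z : Scheme.{u}} (i : Z ⟶ C) : 𝔸(κ; Z) ⟶ C :=
  subgroupHom (i ≫ p) β ≫ σ.sweep i

/-- `U'` acts freely on the open subscheme `W` of `C`: on `T`-valued points, for every
scheme `T`, an element of `U'(T)` that fixes a point of `W(T)` is trivial. -/
def ActsFreelyOn (β : κ → ι → k) (W : C.Opens) : Prop :=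
  ∀ (T : Scheme.{u}) (x : T ⟶ C), x ⁻¹ᵁ W = ⊤ → ∀ c : κ → Γ(T, ⊤),
    σ.smul (lin (x ≫ p) β c) x = x → lin (x ≫ p) β c = 0

end GaAction

/-! ### The situation of a graded additive group acting on an affine cone -/

/-- `p : X ⟶ Spec k` is a variety: an integral scheme, separated and of finite type over `k`. -/
structure IsVariety {k : Type u} [Field k] {X : Scheme.{u}} (p : X ⟶ Spec (.of k)) : Prop where
  isIntegral : IsIntegral X
  isSeparated : IsSeparated p
  locallyOfFiniteType : LocallyOfFiniteType p
  quasiCompact : QuasiCompact p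

section Situation

variable {k : Type u} [Field k] {ι : Type u} {C S : Scheme.{u}} {p : S ⟶ Spec (.of k)}
  {π : C ⟶ S} [IsAffineHom π] (G : ConeGrading π) (σ : GaAction ι (π ≫ p))

/-- The actions of `𝔾_a^ι` and of `𝔾_m` on the cone constitute an action of
`𝔾_a^ι ⋊_w 𝔾_m`, where `𝔾_m` acts on `𝔾_a^ι` with weight `w`: `t.(u.x) = (t ^ w u).(t.x)`. -/
def IsSemidirect (w : ℕ) : Prop :=
  ∀ (T : Scheme.{u}) (t : Γ(T, ⊤)ˣ) (u : ι → Γ(T, ⊤)) (x : T ⟶ C),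
    G.gm t (σ.smul u x) = σ.smul (fun i ↦ (t : Γ(T, ⊤)) ^ w * u i) (G.gm t x)

/-- `d(π) = min_{z ∈ Z} dim Stab_𝔲(z)`, over the `k`-points `z` of the zero section. -/
def minStabDim : ℕ :=
  sInf {d | ∃ z : Spec (.of k) ⟶ S, z ≫ p = 𝟙 _ ∧
    Module.finrank k (σ.stab (z ≫ G.zeroSection)) = d}

end Situation

end GradedAdditive
end

open GradedAdditive

/-! Over an affine open `U` of `S` the action is a coaction `ρ : A → A[u]` on the graded ring `A =
Γ(C, π⁻¹ U)`. Compatibility with `𝔾_m` forces the coefficient of `u^α` in `ρ f`, for `f` of degree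
`n`, to have degree `n - w|α|`. Hence functions of weight `w` transform affinely, `f(u.x) = f(x) + ∑
u_l δ_l f`, with every `δ_l f` a function on the base (`eval₂_of_mem`, `coeff_single_mem`). The same
count shows that derivatives along `Z` only see components of weight `w`, so functions of weight `w`
detect the stabilisers on `Z` (`derivAtZero_decompose`, `mem_stab_iff`).

At one closed point, choose a complement `𝔳` of the stabiliser, with basis `β`, and functions whose
derivatives there are dual to `β`. Cramer's rule turns them into `f_j` with pairing `a δ_ij` over
all of `U`, where `a` is nonzero at the point. Constancy of the stabiliser dimension keeps `𝔳`
complementary wherever `a ≠ 0`; as `U` is reduced, this yields an identity in `Γ(S, U)` expressing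
all derivations through those along `β` (`exists_adapted_complement`, `exists_isSlice`).

Over `D(a)`, an element `c` of `U'` acts by `f_j(c.x) = f_j(x) + c_j a`. This gives freeness; and
since `f_j` vanishes on `Z`, the functions `f_j / a` recover `c` from `c.z`, so `U' × Z → C` is a
closed immersion (`isClosedImmersion_subSweep`). Finally, at a point of `Z` each `u` is the sum of
an element of `U'` and a vector along which all derivatives vanish. In characteristic zero the
latter fixes the point (`eval₂_eq_of_linear_eq_zero`), so the two sweeps factor through each other
and have the same image and kernel. -/

noncomputable section

namespace GradedAdditive

/-! ### Graded coactions: weights of coefficients and infinitesimal stabilisers -/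

section Coaction

open MvPolynomial

variable {A : Type u} [CommRing A] {ι : Type u}

/-- A polynomial evaluated at elements with vanishing pairwise products is determined by its
coefficients of degree at most one. -/
lemma eval₂_of_mul_eq_zero [Fintype ι] {B : Type*} [CommRing B] (ψ : A →+* B) (v : ι → B)
    (hv : ∀ i j, v i * v j = 0) (P : MvPolynomial ι A) :
    eval₂ ψ v P = ψ (coeff 0 P) + ∑ l, v l * ψ (coeff (Finsupp.single l 1) P) := by
  classical
  induction P using MvPolynomial.induction_on with
  | C a => simp [coeff_C, eq_comm]
  | add P Q hP hQ =>
    simp only [eval₂_add, hP, hQ, coeff_add, map_add, mul_add, Finset.sum_add_distrib]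
    ring
  | mul_X P i hP =>
    rw [eval₂_mul, eval₂_X, hP, add_mul, Finset.sum_mul]
    have h1 : ∑ l, v l * ψ (coeff (Finsupp.single l 1) P) * v i = 0 :=
      Finset.sum_eq_zero fun l _ ↦ by rw [mul_right_comm, hv, zero_mul]
    rw [h1, Finset.sum_eq_single i]
    · simp [coeff_mul_X', mul_comm]
    · intro l _ hl
      simp [coeff_mul_X', Ne.symm hl]
    · simp

/-- The algebraic form of a `𝔾_a^ι`-action on `Spec A`, for a graded ring `A`, that is compatible
with the `𝔾_m`-action given by the grading, where `𝔾_m` acts on `𝔾_a^ι` with weight `w`. -/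
structure IsGradedCoaction (𝒜 : ℕ → AddSubgroup A) [GradedRing 𝒜] (w : ℕ)
    (ρ : A →+* MvPolynomial ι A) : Prop where
  coeff_zero (g : A) : coeff 0 (ρ g) = g
  add {B : Type u} [CommRing B] (φ : A →+* B) (u v : ι → B) (g : A) :
    eval₂ φ (u + v) (ρ g) = eval₂ ((eval₂Hom φ v).comp ρ) u (ρ g)
  twist {B : Type u} [CommRing B] (t : Bˣ) (φ : A →+* B) (u : ι → B) (g : A) :
    twist 𝒜 ((eval₂Hom φ u).comp ρ) (t : B) g =
      eval₂ (twist 𝒜 φ (t : B)) (fun i ↦ (t : B) ^ w * u i) (ρ g)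

variable {𝒜 : ℕ → AddSubgroup A} [GradedRing 𝒜]

lemma comp_twist {B B' : Type u} [CommRing B] [CommRing B'] (h : B →+* B') (φ : A →+* B) (t : B) :
    h.comp (twist 𝒜 φ t) = twist 𝒜 (h.comp φ) (h t) := by
  refine graded_hom_ext 𝒜 fun n f hf ↦ ?_
  simp only [RingHom.comp_apply]
  rw [twist_of_mem 𝒜 _ _ hf, twist_of_mem 𝒜 _ _ hf, map_mul, map_pow, RingHom.comp_apply]

lemma coeff_twist_X (g : A) (m : ℕ) :
    (twist 𝒜 (Polynomial.C : A →+* Polynomial A) Polynomial.X g).coeff m =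
      DirectSum.decompose 𝒜 g m := by
  induction g using DirectSum.Decomposition.inductionOn 𝒜 with
  | zero => simp
  | @homogeneous i a =>
    rw [twist_of_mem 𝒜 _ _ a.2, mul_comm, Polynomial.coeff_C_mul_X_pow]
    split_ifs with h
    · subst h; simp
    · rw [DirectSum.decompose_of_mem_ne 𝒜 a.2 (Ne.symm h)]
  | add a b ha hb => simp [ha, hb]

/-- Evaluating at `t ^ w * X_i` with coefficients twisted by `t`, the exponents of `t` record the
degrees of the coefficients, shifted according to the degree of the monomials. -/
lemma coeff_eval₂_twist [Fintype ι] (w : ℕ) (P : MvPolynomial ι A) (α : ι →₀ ℕ) (m : ℕ) :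
    coeff α ((eval₂ (twist 𝒜 ((Polynomial.C).comp (C : A →+* MvPolynomial ι A)) Polynomial.X)
      (fun i ↦ Polynomial.X ^ w * Polynomial.C (X i)) P).coeff (w * α.degree + m)) =
      DirectSum.decompose 𝒜 (coeff α P) m := by
  classical
  induction P using MvPolynomial.induction_on' with
  | monomial β a =>
    have h1 : (β.prod fun i k ↦
        (Polynomial.X ^ w * Polynomial.C (X i) : Polynomial (MvPolynomial ι A)) ^ k) =
        Polynomial.X ^ (w * β.degree) * Polynomial.C (monomial β 1) := by
      simp only [mul_pow, Finsupp.prod_mul, ← pow_mul, ← map_pow]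
      congr 1
      · rw [Finsupp.prod, Finset.prod_pow_eq_pow_sum, Finsupp.degree_apply, Finset.mul_sum]
      · rw [monomial_eq, C_1, one_mul, Finsupp.prod, Finsupp.prod, map_prod]
    have h2 : twist 𝒜 ((Polynomial.C).comp (C : A →+* MvPolynomial ι A)) Polynomial.X a =
        (twist 𝒜 (Polynomial.C : A →+* Polynomial A) Polynomial.X a).map C := by
      have := comp_twist (𝒜 := 𝒜) (Polynomial.mapRingHom (C : A →+* MvPolynomial ι A))
        (Polynomial.C : A →+* Polynomial A) Polynomial.X
      rw [Polynomial.mapRingHom_comp_C, Polynomial.coe_mapRingHom, Polynomial.map_X] at this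
      exact congr($this a).symm
    rw [eval₂_monomial, h1, h2, ← mul_assoc, Polynomial.coeff_mul_C, mul_comm _ (Polynomial.X ^ _),
      Polynomial.coeff_X_pow_mul', Polynomial.coeff_map, coeff_monomial]
    rcases eq_or_ne β α with rfl | h
    · rw [if_pos (Nat.le_add_right _ _), coeff_C_mul, coeff_monomial, if_pos rfl, if_pos rfl,
        mul_one, Nat.add_sub_cancel_left, coeff_twist_X]
    · split_ifs with h'
      · simp [coeff_C_mul, coeff_monomial, h]
      · simp
  | add P Q hP hQ =>
    rw [eval₂_add, Polynomial.coeff_add, coeff_add, hP, hQ, coeff_add, DirectSum.decompose_add]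
    rfl

namespace IsGradedCoaction

variable {w : ℕ} {ρ : A →+* MvPolynomial ι A} (hρ : IsGradedCoaction 𝒜 w ρ)
include hρ

/-- Semidirectness for a generic `t` equates `t^n ρ(f)` with `ρ(f)` evaluated at `t^w u` with
twisted coefficients. On the right, the degree `m` part of the coefficient of `u^α` is carried by
`t^(w|α| + m)`. -/
lemma decompose_coeff [Fintype ι] {n : ℕ} {f : A} (hf : f ∈ 𝒜 n) (α : ι →₀ ℕ) {m : ℕ}
    (hm : w * α.degree + m ≠ n) : (DirectSum.decompose 𝒜 (coeff α (ρ f)) m : A) = 0 := by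
  set B := MvPolynomial ι A
  have key : (Polynomial.X ^ n * Polynomial.C (ρ f) : Polynomial B) =
      eval₂ (GradedAdditive.twist 𝒜 ((Polynomial.C).comp (C : A →+* B)) Polynomial.X)
        (fun i ↦ Polynomial.X ^ w * Polynomial.C (X i)) (ρ f) := by
    -- The compatibility is available only for units `t`, so the variable is inverted; nothing is
    -- lost, as polynomials embed in Laurent polynomials.
    apply Polynomial.toLaurent_injective
    have ht : IsUnit (Polynomial.toLaurent (Polynomial.X : Polynomial B)) := by
      rw [Polynomial.toLaurent_X]; exact LaurentPolynomial.isUnit_T 1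
    have := hρ.twist ht.unit (Polynomial.toLaurent.comp ((Polynomial.C).comp (C : A →+* B)))
      (fun i ↦ Polynomial.toLaurent (Polynomial.C (X i))) f
    rw [twist_of_mem 𝒜 _ _ hf, IsUnit.unit_spec, ← comp_twist] at this
    rw [map_mul, map_pow, hom_eval₂]
    simp only [map_mul, map_pow]
    refine Eq.trans ?_ this
    congr 1
    conv_lhs => rw [← eval₂_eta (ρ f)]
    rw [← RingHom.comp_apply, hom_eval₂]
    rfl
  rw [← coeff_eval₂_twist w (ρ f) α m, ← key, Polynomial.coeff_mul_C, Polynomial.coeff_X_pow,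
    if_neg hm, zero_mul, MvPolynomial.coeff_zero]

lemma coeff_eq_zero [Fintype ι] {n : ℕ} {f : A} (hf : f ∈ 𝒜 n) (α : ι →₀ ℕ)
    (h : n < w * α.degree) : coeff α (ρ f) = 0 := by
  classical
  rw [← DirectSum.sum_support_decompose 𝒜 (coeff α (ρ f))]
  exact Finset.sum_eq_zero fun m _ ↦ hρ.decompose_coeff hf α (by omega)

lemma coeff_single_mem [Fintype ι] {f : A} (hf : f ∈ 𝒜 w) (l : ι) :
    coeff (Finsupp.single l 1) (ρ f) ∈ 𝒜 0 := by
  classical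
  rw [← DirectSum.sum_support_decompose 𝒜 (coeff (Finsupp.single l 1) (ρ f))]
  refine sum_mem fun m _ ↦ ?_
  rcases eq_or_ne m 0 with rfl | hm
  · exact SetLike.coe_mem _
  · rw [hρ.decompose_coeff hf _ (by simpa using hm)]
    exact zero_mem _

/-- Monomials with `|α| ≥ 2` would need coefficients of degree `w - w|α| < 0`, so only the constant
and linear terms survive. -/
lemma eval₂_of_mem [Fintype ι] (hw : 0 < w) {B : Type*} [CommRing B] (φ : A →+* B) (u : ι → B)
    {f : A} (hf : f ∈ 𝒜 w) :
    eval₂ φ u (ρ f) = φ f + ∑ l, u l * φ (coeff (Finsupp.single l 1) (ρ f)) := by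
  classical
  have h : ρ f = C f + ∑ l, C (coeff (Finsupp.single l 1) (ρ f)) * X l := by
    ext α
    rw [coeff_add, coeff_sum, coeff_C]
    simp only [coeff_C_mul, coeff_X, mul_ite, mul_one, mul_zero]
    rcases eq_or_ne α 0 with rfl | h0
    · simp [hρ.coeff_zero]
    rw [if_neg h0.symm, zero_add]
    by_cases h1 : α ∈ Set.range fun l : ι ↦ Finsupp.single l 1
    · obtain ⟨l, rfl⟩ := h1
      simp [Finsupp.single_left_inj]
    · rw [Finset.sum_eq_zero fun l _ ↦ if_neg fun h ↦ h1 ⟨l, h⟩]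
      refine hρ.coeff_eq_zero hf α ?_
      have h0' : α.degree ≠ 0 := by rwa [Ne, Finsupp.degree_eq_zero_iff]
      have h1' : α.degree ≠ 1 := by rwa [Finsupp.range_single_one] at h1
      nlinarith [show 2 ≤ α.degree by omega]
  conv_lhs => rw [h]
  simp [eval₂_sum, mul_comm]

lemma map_zero_mem [Fintype ι] (hw : 0 < w) {a : A} (ha : a ∈ 𝒜 0) : ρ a = C a := by
  classical
  ext α
  rw [coeff_C]
  split_ifs with h
  · rw [← h, hρ.coeff_zero]
  · refine hρ.coeff_eq_zero ha α (Nat.mul_pos hw (Nat.pos_of_ne_zero ?_))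
    rwa [Ne, Finsupp.degree_eq_zero_iff, eq_comm]

/-- In characteristic zero, an element of the Lie algebra that stabilises a point infinitesimally
belongs to the stabiliser of that point. -/
lemma eval₂_eq_of_linear_eq_zero [Fintype ι] {B : Type u} [CommRing B] [IsAddTorsionFree B]
    (φ : A →+* B) (ξ : ι → B)
    (hξ : ∀ g, ∑ l, ξ l * φ (coeff (Finsupp.single l 1) (ρ g)) = 0) (g : A) :
    eval₂ φ ξ (ρ g) = φ g := by
  -- `F` is the value of `g` along the line `a ↦ (aξ).x`; the aim is `F(1) = F(0)`.
  let F : Polynomial B :=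
    eval₂ ((Polynomial.C).comp φ) (fun i ↦ Polynomial.C (ξ i) * Polynomial.X) (ρ g)
  have hF (a : B) : F.eval a = eval₂ φ (fun i ↦ ξ i * a) (ρ g) := by
    change Polynomial.evalRingHom a F = _
    rw [hom_eval₂]
    congr 1
    · ext; simp
    · ext; simp
  let ψ : A →+* DualNumber (Polynomial B) :=
    (algebraMap (Polynomial B) _).comp ((Polynomial.C).comp φ)
  let x : DualNumber (Polynomial B) := algebraMap (Polynomial B) _ Polynomial.X
  let y : DualNumber (Polynomial B) := DualNumber.eps
  have hy : y * y = 0 := DualNumber.eps_mul_eps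
  let c : B →+* DualNumber (Polynomial B) := (algebraMap (Polynomial B) _).comp Polynomial.C
  -- By `hξ`, the vector `εξ` fixes the point. Additivity of the action then gives `F(X + ε) = F(X)`
  -- over `B[X][ε]`, hence `F' = 0` by Taylor expansion.
  have h1 : (eval₂Hom ψ (fun i ↦ c (ξ i) * y)).comp ρ = ψ := by
    ext1 g
    rw [RingHom.comp_apply, coe_eval₂Hom, eval₂_of_mul_eq_zero, hρ.coeff_zero]
    · have : ∀ l, c (ξ l) * y * ψ (coeff (Finsupp.single l 1) (ρ g)) =
          c (ξ l * φ (coeff (Finsupp.single l 1) (ρ g))) * y := fun l ↦ by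
        rw [map_mul, mul_right_comm]; rfl
      simp only [this, ← Finset.sum_mul, ← map_sum, hξ, map_zero, zero_mul, add_zero]
    · intro i j
      rw [mul_mul_mul_comm, hy, mul_zero]
  have h2 := hρ.add ψ (fun i ↦ c (ξ i) * x) (fun i ↦ c (ξ i) * y) g
  rw [h1] at h2
  have h3 (z : DualNumber (Polynomial B)) :
      Polynomial.aeval z F = eval₂ ψ (fun i ↦ c (ξ i) * z) (ρ g) := by
    rw [← AlgHom.coe_toRingHom, hom_eval₂]
    congr 1
    · ext1 a; simp [ψ, TrivSqZeroExt.algebraMap_eq_inl]; rfl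
    · ext1 a; simp [c]; rfl
  have h4 : ((fun i ↦ c (ξ i) * x) + fun i ↦ c (ξ i) * y) = fun i ↦ c (ξ i) * (x + y) := by
    ext1 i; simp [mul_add]
  rw [h4, ← h3, ← h3, Polynomial.aeval_add_of_sq_eq_zero _ _ _ (by rw [sq, hy]),
    add_eq_left] at h2
  have h5 : Polynomial.aeval x (Polynomial.derivative F) =
      algebraMap (Polynomial B) _ (Polynomial.derivative F) := by
    rw [Polynomial.aeval_algebraMap_apply]; simp
  rw [h5] at h2
  have h6 : Polynomial.derivative F = 0 := by
    have := congrArg TrivSqZeroExt.snd h2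
    simpa [y, TrivSqZeroExt.algebraMap_eq_inl] using this
  -- Torsion-freeness of `B` is used here: zero derivative forces `F` to be constant.
  obtain ⟨a, ha⟩ := 
    Polynomial.natDegree_eq_zero.1 (Polynomial.derivative_eq_zero.1 h6)
  have e0 := hF 0
  have e1 := hF 1
  simp only [← ha, Polynomial.eval_C, mul_one, mul_zero] at e0 e1
  rw [← e1, e0]
  have := eval₂_of_mul_eq_zero φ (fun _ : ι ↦ (0 : B)) (by simp) (ρ g)
  simpa [hρ.coeff_zero] using this

end IsGradedCoaction

end Coaction

/-! ### Rational points and the Nullstellensatz -/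

section Points

variable {k R : Type*} [Field k] [IsAlgClosed k] [CommRing R] [Algebra k R]
  [Algebra.FiniteType k R]

variable (k) in
/-- Maximal ideals of finitely generated algebras over an algebraically closed field are kernels
of rational points. -/
lemma exists_algHom_of_isMaximal (m : Ideal R) [m.IsMaximal] :
    ∃ ζ : R →ₐ[k] k, ∀ r, ζ r = 0 ↔ r ∈ m := by
  let := Ideal.Quotient.field m
  have : Algebra.FiniteType k (R ⧸ m) :=
    .of_surjective (Ideal.Quotient.mkₐ k m) Ideal.Quotient.mk_surjective
  have : Module.Finite k (R ⧸ m) := finite_of_finite_type_of_isJacobsonRing k (R ⧸ m)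
  have hb : Function.Bijective (algebraMap k (R ⧸ m)) :=
    IsAlgClosed.algebraMap_bijective_of_isIntegral
  let e : k ≃ₐ[k] R ⧸ m := AlgEquiv.ofBijective (Algebra.ofId k _) hb
  refine ⟨e.symm.toAlgHom.comp (Ideal.Quotient.mkₐ k m), fun r ↦ ?_⟩
  change e.symm (Ideal.Quotient.mk m r) = 0 ↔ _
  rw [map_eq_zero_iff _ e.symm.injective, Ideal.Quotient.eq_zero_iff_mem]

variable (k) in
lemma eq_zero_of_forall_algHom [IsReduced R] {r : R} (h : ∀ ζ : R →ₐ[k] k, ζ r = 0) : r = 0 := by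
  have : IsJacobsonRing R := isJacobsonRing_of_finiteType (A := k)
  have h1 : Ideal.jacobson (⊥ : Ideal R) = ⊥ :=
    isJacobsonRing_iff.1 ‹_› ⊥ Ideal.isRadical_bot
  rw [← Ideal.mem_bot, ← h1, Ideal.jacobson, Ideal.mem_sInf]
  rintro m ⟨-, hm⟩
  obtain ⟨ζ, hζ⟩ := exists_algHom_of_isMaximal k m
  exact (hζ r).1 (h ζ)

end Points

/-! ### Linear algebra of stabilisers of constant dimension -/

section Stab

variable {k R M ι : Type*} [Field k] [CommRing R] [Algebra k R] [AddCommGroup M] [Module R M]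
  [Fintype ι] (δ : ι → M →ₗ[R] R)

/-- The vectors `ξ ∈ k^ι` such that `∑ l, ξ_l δ_l` vanishes at the point `ζ`. -/
def stabAt (ζ : R →ₐ[k] k) : Submodule k (ι → k) :=
  ⨅ m, LinearMap.ker (Fintype.linearCombination k fun l ↦ ζ (δ l m))

variable {δ}

lemma mem_stabAt {ζ : R →ₐ[k] k} {ξ : ι → k} :
    ξ ∈ stabAt δ ζ ↔ ∀ m, ∑ l, ξ l * ζ (δ l m) = 0 := by
  simp [stabAt, Fintype.linearCombination_apply]

/-- The `f j` are a dual family to the basis `β` of a complement at `ζ₀`, extended over `R` up to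
the determinant `a`. The last identity is the projection onto the span of `β` along the stabilisers,
with its denominator cleared; it is checked at rational points, which suffices because `R` is a
reduced finitely generated algebra. -/
lemma exists_adapted_complement [IsAlgClosed k] [Algebra.FiniteType k R] [IsDomain R] {d : ℕ}
    (hd : ∀ ζ : R →ₐ[k] k, Module.finrank k (stabAt δ ζ) = d) (ζ₀ : R →ₐ[k] k) :
    ∃ (b : ℕ) (β : ULift.{u} (Fin b) → ι → k) (f : ULift.{u} (Fin b) → M) (a : R),
      LinearIndependent k β ∧ ζ₀ a ≠ 0 ∧
      (∀ i j, ∑ l, algebraMap k R (β i l) * δ l (f j) = if i = j then a else 0) ∧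
      (∀ ζ : R →ₐ[k] k, ζ a ≠ 0 → IsCompl (Submodule.span k (Set.range β)) (stabAt δ ζ)) ∧
      ∀ l m, a * δ l m = ∑ j, δ l (f j) * ∑ i, algebraMap k R (β j i) * δ i m := by
  classical
  obtain ⟨W, hW⟩ := Submodule.exists_isCompl (stabAt δ ζ₀)
  set b := Module.finrank k W
  let B : Module.Basis (ULift.{u} (Fin b)) k W :=
    (Module.finBasis k W).reindex Equiv.ulift.symm
  let β : ULift.{u} (Fin b) → ι → k := fun j ↦ (B j : ι → k)
  have hβ : LinearIndependent k β := B.linearIndependent.map' W.subtype (by simp)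
  have hspan : Submodule.span k (Set.range β) = W := by
    have := B.span_eq
    rw [show Set.range β = W.subtype '' Set.range B by rw [← Set.range_comp]; rfl,
      Submodule.span_image, this, Submodule.map_top, Submodule.range_subtype]
  let μ : ULift.{u} (Fin b) → M →ₗ[R] R := fun j ↦ ∑ l, algebraMap k R (β j l) • δ l
  have hμ (j) (m : M) : μ j m = ∑ l, algebraMap k R (β j l) * δ l m := by
    simp [μ, Algebra.smul_def]
  have hζμ (ζ : R →ₐ[k] k) (j) (m : M) :
      Fintype.linearCombination k (fun l ↦ ζ (δ l m)) (β j) = ζ (μ j m) := by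
    simp [hμ, Fintype.linearCombination_apply]
  -- The evaluations `m ↦ (ζ₀ (μ j m))_j` are surjective: a functional killing the image would
  -- define a nonzero vector of `W` lying in the stabiliser at `ζ₀`.
  have hfill : ∀ c : ULift.{u} (Fin b) → k, ∃ m : M, ∀ j, ζ₀ (μ j m) = c j := by
    let N : Submodule k (ULift.{u} (Fin b) → k) :=
      { carrier := Set.range fun m j ↦ ζ₀ (μ j m)
        zero_mem' := ⟨0, by ext; simp⟩
        add_mem' := by
          rintro _ _ ⟨m, rfl⟩ ⟨m', rfl⟩
          exact ⟨m + m', by ext; simp⟩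
        smul_mem' := by
          rintro c _ ⟨m, rfl⟩
          exact ⟨algebraMap k R c • m, by ext; simp⟩ }
    have hN : N = ⊤ := by
      by_contra hN
      obtain ⟨g, hg0, hg⟩ := Submodule.exists_le_ker_of_lt_top N (lt_top_iff_ne_top.2 hN)
      refine hg0 ?_
      set ξ : ι → k := ∑ j, g (Pi.single j 1) • β j with hξ
      have h1 : ξ ∈ stabAt δ ζ₀ := by
        simp only [stabAt, Submodule.mem_iInf, LinearMap.mem_ker]
        intro m
        have : g (fun j ↦ ζ₀ (μ j m)) = 0 := hg ⟨m, rfl⟩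
        rw [LinearMap.pi_apply_eq_sum_univ g] at this
        rw [hξ, map_sum, ← this]
        refine Finset.sum_congr rfl fun j _ ↦ ?_
        rw [map_smul, hζμ, smul_eq_mul, smul_eq_mul, mul_comm]
        congr 2
        ext i; simp [Pi.single_apply, eq_comm]
      have h2 : ξ ∈ W := sum_mem fun j _ ↦ W.smul_mem _ (B j).2
      have h3 : ξ = 0 := Submodule.disjoint_def.1 hW.disjoint ξ h1 h2
      have h4 := Fintype.linearIndependent_iff.1 hβ _ h3
      exact LinearMap.pi_ext' fun j ↦ LinearMap.ext_ring (by simpa using h4 j)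
    intro c
    obtain ⟨m, hm⟩ : c ∈ N := hN ▸ Submodule.mem_top
    exact ⟨m, fun j ↦ congrFun hm j⟩
  choose g hg using fun j ↦ hfill (Pi.single j 1)
  -- `X` is the identity matrix at `ζ₀`. Combining the `g m` by its adjugate makes the pairing
  -- matrix `det X` times the identity without inverting anything.
  let X : Matrix (ULift.{u} (Fin b)) (ULift.{u} (Fin b)) R := .of fun i j ↦ μ i (g j)
  let a := X.det
  let f : ULift.{u} (Fin b) → M := fun j ↦ ∑ m, X.adjugate m j • g m
  have hf (i j) : μ i (f j) = if i = j then a else 0 := by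
    have : (X * X.adjugate) i j = if i = j then a else 0 := by
      rw [Matrix.mul_adjugate, Matrix.smul_apply, Matrix.one_apply]; simp [a]
    rw [← this, Matrix.mul_apply, map_sum]
    refine Finset.sum_congr rfl fun m _ ↦ ?_
    rw [map_smul, smul_eq_mul, mul_comm]; rfl
  have ha : ζ₀ a ≠ 0 := by
    have : ζ₀ a = 1 := by
      rw [show ζ₀ a = (ζ₀ : R →+* k) X.det from rfl, RingHom.map_det,
        show (ζ₀ : R →+* k).mapMatrix X = 1 from ?_, Matrix.det_one]
      ext i j
      simp [X, hg, Matrix.one_apply, Pi.single_apply]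
    simp [this]
  have hcompl (ζ : R →ₐ[k] k) (hζ : ζ a ≠ 0) :
      IsCompl (Submodule.span k (Set.range β)) (stabAt δ ζ) := by
    have hdis : Disjoint (Submodule.span k (Set.range β)) (stabAt δ ζ) := by
      rw [Submodule.disjoint_def]
      intro ξ h1 h2
      obtain ⟨c, rfl⟩ := (Submodule.mem_span_range_iff_exists_fun k).1 h1
      refine Finset.sum_eq_zero fun i _ ↦ ?_
      simp only [stabAt, Submodule.mem_iInf, LinearMap.mem_ker, map_sum, map_smul, hζμ] at h2
      have := h2 (f i)
      simp only [hf, apply_ite ζ, map_zero, smul_ite, smul_zero] at this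
      have : c i = 0 := by simpa [hζ] using this
      rw [this, zero_smul]
    -- Disjointness is improved to complementarity by dimension: `W` was complementary at `ζ₀`, and
    -- all stabilisers have dimension `d`.
    refine ⟨hdis, codisjoint_iff.2 (Submodule.eq_top_of_disjoint _ _ ?_ hdis)⟩
    rw [hd, ← hd ζ₀, hspan, add_comm, Submodule.finrank_add_eq_of_isCompl hW]
  refine ⟨b, β, f, a, hβ, ha, fun i j ↦ by rw [← hf, hμ], hcompl, fun l m ↦ ?_⟩
  have ha0 : a ≠ 0 := fun h ↦ ha (by rw [h, map_zero])
  rw [← sub_eq_zero]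
  -- The extra factor `a` makes the identity trivial where `ζ a = 0`; it is cancelled in the domain
  -- `R`.
  refine (mul_eq_zero.1 (eq_zero_of_forall_algHom k (r := a * _) fun ζ ↦ ?_)).resolve_left ha0
  by_cases hζ : ζ a = 0
  · rw [map_mul, hζ, zero_mul]
  -- The basis vector `e_l` is split along the complement and the stabiliser at `ζ`. Pairing with `f
  -- j` then identifies its coordinates as `ζ (δ l (f j)) / ζ a`.
  obtain ⟨ξ, hξ, η, hη, hsum⟩ := Submodule.mem_sup.1
    ((hcompl ζ hζ).sup_eq_top ▸ Submodule.mem_top : (Pi.single l 1 : ι → k) ∈ _)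
  obtain ⟨c, rfl⟩ := (Submodule.mem_span_range_iff_exists_fun k).1 hξ
  simp only [stabAt, Submodule.mem_iInf, LinearMap.mem_ker] at hη
  have key (m : M) : ζ (δ l m) = ∑ j, c j * ζ (μ j m) := by
    have := congrArg (Fintype.linearCombination k (fun l ↦ ζ (δ l m))) hsum
    rw [map_add, hη, add_zero, map_sum] at this
    simp only [map_smul, hζμ, smul_eq_mul, Fintype.linearCombination_apply_single, one_mul] at this
    exact this.symm
  have key' (j) : ζ (δ l (f j)) = c j * ζ a := by
    simp [key, hf, apply_ite ζ]
  simp only [← hμ, map_mul, map_sub, map_sum, key', key m]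
  rw [Finset.mul_sum, ← Finset.sum_sub_distrib, Finset.sum_eq_zero, mul_zero]
  intro j _
  ring

end Stab

/-! ### Points of an affine open subscheme as ring homomorphisms -/

section AffinePoints

variable {C T T' : Scheme.{u}} {W : C.Opens}

/-- The ring homomorphism `Γ(C, W) → Γ(T, ⊤)` given by a morphism `T ⟶ C` with image in `W`. -/
def evalAt (x : T ⟶ C) (h : ⊤ ≤ x ⁻¹ᵁ W) : Γ(C, W) →+* Γ(T, ⊤) := (x.appLE W ⊤ h).hom

lemma evalAt_comp (g : T' ⟶ T) (x : T ⟶ C) (h : ⊤ ≤ x ⁻¹ᵁ W) (h' : ⊤ ≤ (g ≫ x) ⁻¹ᵁ W) :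
    evalAt (g ≫ x) h' = g.appTop.hom.comp (evalAt x h) := by
  have h1 := Scheme.Hom.appLE_comp_appLE g x W ⊤ ⊤ h le_top
  rw [show g.appLE ⊤ ⊤ le_top = g.appTop from g.appLE_eq_app] at h1
  exact congr(($h1).hom).symm

variable (hW : IsAffineOpen W)
include hW

lemma eq_of_evalAt (x : T ⟶ C) (h : ⊤ ≤ x ⁻¹ᵁ W) :
    T.toSpecΓ ≫ Spec.map (CommRingCat.ofHom (evalAt x h)) ≫ hW.fromSpec = x := by
  have h1 := Scheme.Opens.toSpecΓ_SpecMap_appLE x W ⊤ h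
  rw [Scheme.Opens.toSpecΓ_top] at h1
  have h2 := congr($h1 ≫ hW.fromSpec)
  simp only [Category.assoc, IsAffineOpen.toSpecΓ_fromSpec, Scheme.Hom.resLE_comp_ι] at h2
  have : IsIso (⊤ : T.Opens).ι := inferInstanceAs (IsIso T.topIso.hom)
  exact (cancel_epi _).1 h2

lemma evalAt_injective {x y : T ⟶ C} (hx : ⊤ ≤ x ⁻¹ᵁ W) (hy : ⊤ ≤ y ⁻¹ᵁ W)
    (h : evalAt x hx = evalAt y hy) : x = y := by
  rw [← eq_of_evalAt hW x hx, ← eq_of_evalAt hW y hy, h]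

/-- The `B`-valued point of `C` given by a ring homomorphism `Γ(C, W) → B`. -/
def specPoint {B : Type u} [CommRing B] (φ : Γ(C, W) →+* B) : Spec (.of B) ⟶ C :=
  Spec.map (CommRingCat.ofHom φ) ≫ hW.fromSpec

variable {B : Type u} [CommRing B] (φ : Γ(C, W) →+* B)

lemma le_specPoint_preimage : ⊤ ≤ specPoint hW φ ⁻¹ᵁ W := by
  rw [specPoint, Scheme.Hom.comp_preimage, hW.fromSpec_preimage_self]
  exact le_rfl

lemma evalAt_specPoint (h : ⊤ ≤ specPoint hW φ ⁻¹ᵁ W) :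
    evalAt (specPoint hW φ) h = (Scheme.ΓSpecIso (.of B)).inv.hom.comp φ := by
  have h1 : (⊤ : (Spec Γ(C, W)).Opens) ≤ hW.fromSpec ⁻¹ᵁ W := hW.fromSpec_preimage_self.ge
  have h2 : evalAt hW.fromSpec h1 = (Scheme.ΓSpecIso Γ(C, W)).inv.hom := by
    have := hW.fromSpec_app_self
    rw [evalAt, Scheme.Hom.appLE, this, Category.assoc, ← Functor.map_comp]
    erw [CategoryTheory.Functor.map_id, Category.comp_id]
  refine (evalAt_comp _ _ h1 _).trans ?_
  rw [h2]
  have := Scheme.ΓSpecIso_inv_naturality (CommRingCat.ofHom φ)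
  exact congr(($this).hom).symm

end AffinePoints

lemma toSpecΓ_comp_appTop {T : Scheme.{u}} {B : Type u} [CommRing B] (ψ : B →+* Γ(T, ⊤)) (b : B) :
    (T.toSpecΓ ≫ Spec.map (CommRingCat.ofHom ψ)).appTop ((Scheme.ΓSpecIso (.of B)).inv b) =
      ψ b := by
  have h := Scheme.ΓSpecIso_inv_naturality (CommRingCat.ofHom ψ)
  have h1 := congr(($h).hom b)
  simp only [Scheme.Hom.comp_appTop, CommRingCat.comp_apply]
  rw [CommRingCat.hom_comp, RingHom.comp_apply, CommRingCat.hom_comp, RingHom.comp_apply] at h1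
  erw [← h1]
  rw [Scheme.toSpecΓ_appTop]
  exact congr(($((Scheme.ΓSpecIso Γ(T, ⊤)).inv_hom_id)).hom (ψ b))

/-! ### The coaction of a stable affine open subscheme -/

namespace GaAction

open MvPolynomial

variable {k : Type u} [Field k] {ι : Type u} {C : Scheme.{u}} {p : C ⟶ Spec (.of k)}
  (σ : GaAction ι p) {W : C.Opens} (hW : IsAffineOpen W)

/-- The open subscheme `W` is stable under the action. -/
def Stable (W : C.Opens) : Prop :=
  ∀ {T : Scheme.{u}} (u : ι → Γ(T, ⊤)) {x : T ⟶ C}, ⊤ ≤ x ⁻¹ᵁ W → ⊤ ≤ σ.smul u x ⁻¹ᵁ W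

variable {σ} (hσ : σ.Stable W)

/-- The action on a stable affine open subscheme, on rings. -/
def coaction : Γ(C, W) →+* MvPolynomial ι Γ(C, W) :=
  (Scheme.ΓSpecIso (.of (MvPolynomial ι Γ(C, W)))).hom.hom.comp
    (evalAt (σ.smul (fun i ↦ (Scheme.ΓSpecIso (.of (MvPolynomial ι Γ(C, W)))).inv (X i))
      (specPoint hW MvPolynomial.C)) (hσ _ (le_specPoint_preimage hW _)))

/-- The coaction is defined by the universal pair `(u₀, x₀)` over `Γ(C, W)[u]`; every pair `(u, x)`
with `x` landing in `W` is its pullback along `g`. -/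
lemma evalAt_smul {T : Scheme.{u}} (u : ι → Γ(T, ⊤)) (x : T ⟶ C) (h : ⊤ ≤ x ⁻¹ᵁ W)
    (h' : ⊤ ≤ σ.smul u x ⁻¹ᵁ W) :
    evalAt (σ.smul u x) h' = (eval₂Hom (evalAt x h) u).comp (coaction hW hσ) := by
  set x₀ := specPoint hW (MvPolynomial.C : _ →+* MvPolynomial ι Γ(C, W))
  set u₀ : ι → Γ(Spec (.of (MvPolynomial ι Γ(C, W))), ⊤) :=
    fun i ↦ (Scheme.ΓSpecIso (.of (MvPolynomial ι Γ(C, W)))).inv (X i)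
  set ψ := eval₂Hom (evalAt x h) u
  set g : T ⟶ Spec (.of (MvPolynomial ι Γ(C, W))) := T.toSpecΓ ≫ Spec.map (CommRingCat.ofHom ψ)
    with hg
  have h1 : g ≫ x₀ = x := by
    change (T.toSpecΓ ≫ Spec.map _) ≫ Spec.map _ ≫ hW.fromSpec = x
    rw [Category.assoc, ← Spec.map_comp_assoc, ← CommRingCat.ofHom_comp, eval₂Hom_comp_C,
      eq_of_evalAt]
  have h2 (i : ι) : g.appTop (u₀ i) = u i := by
    rw [hg]
    refine (toSpecΓ_comp_appTop ψ (X i)).trans ?_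
    simp [ψ]
  have h3 : g ≫ σ.smul u₀ x₀ = σ.smul u x := by
    rw [comp_smul, h1]
    simp only [h2]
  have h4 : ⊤ ≤ σ.smul u₀ x₀ ⁻¹ᵁ W := hσ _ (le_specPoint_preimage hW _)
  have h5 : evalAt (g ≫ σ.smul u₀ x₀) (h3 ▸ h') = evalAt (σ.smul u x) h' := by
    congr
  rw [← h5, evalAt_comp _ _ h4]
  ext f
  have := toSpecΓ_comp_appTop ψ (coaction hW hσ f)
  rw [RingHom.comp_apply, RingHom.comp_apply, ← this]
  congr 1
  change _ = ((Scheme.ΓSpecIso (.of (MvPolynomial ι Γ(C, W)))).hom ≫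
    (Scheme.ΓSpecIso (.of (MvPolynomial ι Γ(C, W)))).inv).hom (evalAt (σ.smul u₀ x₀) h4 f)
  rw [Iso.hom_inv_id]
  rfl

end GaAction

lemma ConeGrading.evalAt_gm {C S : Scheme.{u}} {π : C ⟶ S} [IsAffineHom π] (G : ConeGrading π)
    (U : S.affineOpens) {T : Scheme.{u}} (t : Γ(T, ⊤)ˣ) (x : T ⟶ C) (h : ⊤ ≤ x ⁻¹ᵁ (π ⁻¹ᵁ U.1))
    (h' : ⊤ ≤ G.gm t x ⁻¹ᵁ (π ⁻¹ᵁ U.1)) :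
    evalAt (G.gm t x) h' = twist (G.piece U) (evalAt x h) t := by
  refine graded_hom_ext (G.piece U) fun n f hf ↦ ?_
  rw [twist_of_mem _ _ _ hf]
  have e : (x ≫ π) ⁻¹ᵁ U.1 ≤ G.gm t x ⁻¹ᵁ (π ⁻¹ᵁ U.1) := by
    rw [← Scheme.Hom.comp_preimage, G.gm_comp]
  set j : Opposite.op ((x ≫ π) ⁻¹ᵁ U.1) ⟶ Opposite.op ⊤ :=
    (homOfLE (show ⊤ ≤ (x ≫ π) ⁻¹ᵁ U.1 from h)).op
  have h1 := congr(T.presheaf.map j $(G.gm_appLE t x U e n f hf))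
  rw [map_mul, map_pow] at h1
  have h2 := congr(($((G.gm t x).appLE_map e j)).hom f)
  have h3 := congr(($(x.appLE_map (U := π ⁻¹ᵁ U.1) (V := (x ≫ π) ⁻¹ᵁ U.1) le_rfl j)).hom f)
  have h4 : T.presheaf.map j (T.presheaf.map (homOfLE le_top).op (t : Γ(T, ⊤))) = t := by
    refine congr(($((T.presheaf.map_comp (homOfLE le_top).op j).symm)).hom (t : Γ(T, ⊤))).trans ?_
    exact congr(($(T.presheaf.map_id _)).hom (t : Γ(T, ⊤)))
  rw [h4] at h1
  refine h2.symm.trans (h1.trans ?_)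
  congr 1

lemma evalAt_app {C S T : Scheme.{u}} (π : C ⟶ S) {U : S.Opens} (x : T ⟶ C)
    (h : ⊤ ≤ x ⁻¹ᵁ (π ⁻¹ᵁ U)) (h' : ⊤ ≤ (x ≫ π) ⁻¹ᵁ U) (a : Γ(S, U)) :
    evalAt x h (π.app U a) = evalAt (x ≫ π) h' a := by
  have := Scheme.Hom.comp_appLE x π U ⊤ h'
  exact congr(($this).hom a).symm

/-! ### Scalars and `k`-points of the base -/

section Base

variable {k : Type u} [Field k] {S T : Scheme.{u}} (p : S ⟶ Spec (.of k)) (U : S.Opens)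

/-- The structure homomorphism `k → Γ(S, U)` of an open subscheme of a `k`-scheme. -/
def baseHom : k →+* Γ(S, U) :=
  (p.appLE ⊤ U le_top).hom.comp (Scheme.ΓSpecIso (.of k)).inv.hom

variable {U}

lemma evalAt_baseHom (x : T ⟶ S) (h : ⊤ ≤ x ⁻¹ᵁ U) (c : k) :
    evalAt x h (baseHom p U c) = scalar (x ≫ p) c := by
  have h1 := Scheme.Hom.appLE_comp_appLE x p ⊤ U ⊤ le_top h
  rw [show (x ≫ p).appLE ⊤ ⊤ _ = (x ≫ p).appTop from (x ≫ p).appLE_eq_app] at h1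
  exact congr(($h1).hom ((Scheme.ΓSpecIso (.of k)).inv c))

lemma eq_of_scalar_eq {X : Scheme.{u}} {q q' : X ⟶ Spec (.of k)} (h : scalar q = scalar q') :
    q = q' := by
  apply ext_of_isAffine
  rw [← cancel_epi (Scheme.ΓSpecIso (.of k)).inv]
  exact CommRingCat.hom_ext h

lemma comp_scalar {X Y : Scheme.{u}} (g : X ⟶ Y) (q : Y ⟶ Spec (.of k)) (c : k) :
    g.appTop (scalar q c) = scalar (g ≫ q) c := by
  rw [scalar, scalar, Scheme.Hom.comp_appTop]
  rfl

lemma ΓSpecIso_hom_scalar_id (c : k) :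
    (Scheme.ΓSpecIso (.of k)).hom (scalar (𝟙 (Spec (.of k))) c) = c := by
  simp [scalar]

lemma baseHom_finiteType [LocallyOfFiniteType p] (hU : IsAffineOpen U) :
    (baseHom p U).FiniteType := by
  refine RingHom.FiniteType.comp (p.finiteType_appLE (isAffineOpen_top _) hU _) ?_
  exact RingHom.FiniteType.of_surjective _
    (Scheme.ΓSpecIso (.of k)).commRingCatIsoToRingEquiv.symm.surjective

lemma isAddTorsionFree_of_scalar [CharZero k] {X : Scheme.{u}} (q : X ⟶ Spec (.of k)) :
    IsAddTorsionFree Γ(X, ⊤) where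
  nsmul_right_injective n hn a b h := by
    have hn' : (n : k) ≠ 0 := Nat.cast_ne_zero.2 hn
    have h1 : scalar q (n : k)⁻¹ * (n : Γ(X, ⊤)) = 1 := by
      rw [← map_natCast (scalar q) n, ← map_mul, inv_mul_cancel₀ hn', map_one]
    simp only [nsmul_eq_mul] at h
    rw [← one_mul a, ← one_mul b, ← h1, mul_assoc, mul_assoc, h]

/-- The ring homomorphism `Γ(S, U) → k` given by a `k`-point. -/
def pointHom (z : Spec (.of k) ⟶ S) (h : ⊤ ≤ z ⁻¹ᵁ U) : Γ(S, U) →+* k :=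
  (Scheme.ΓSpecIso (.of k)).hom.hom.comp (evalAt z h)

lemma evalAt_eq_pointHom (z : Spec (.of k) ⟶ S) (h : ⊤ ≤ z ⁻¹ᵁ U) :
    evalAt z h = (Scheme.ΓSpecIso (.of k)).inv.hom.comp (pointHom z h) := by
  ext a
  exact congr(($((Scheme.ΓSpecIso (.of k)).hom_inv_id)).hom (evalAt z h a)).symm

lemma pointHom_baseHom (z : Spec (.of k) ⟶ S) (h : ⊤ ≤ z ⁻¹ᵁ U) (hz : z ≫ p = 𝟙 _) (c : k) :
    pointHom z h (baseHom p U c) = c := by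
  rw [pointHom, RingHom.comp_apply, evalAt_baseHom, hz]
  exact ΓSpecIso_hom_scalar_id c

lemma pointHom_specPoint (hU : IsAffineOpen U) (ζ : Γ(S, U) →+* k) :
    pointHom (specPoint hU ζ) (le_specPoint_preimage hU ζ) = ζ := by
  rw [pointHom, evalAt_specPoint]
  ext a
  exact congr(($((Scheme.ΓSpecIso (.of k)).inv_hom_id)).hom (ζ a))

lemma specPoint_comp (hU : IsAffineOpen U) (ζ : Γ(S, U) →+* k)
    (hζ : ∀ c, ζ (baseHom p U c) = c) : specPoint hU ζ ≫ p = 𝟙 _ := by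
  apply eq_of_scalar_eq
  ext c
  rw [← evalAt_baseHom p _ (le_specPoint_preimage hU ζ), evalAt_specPoint, RingHom.comp_apply, hζ]
  simp [scalar]

end Base

lemma isUnit_evalAt {S T : Scheme.{u}} {U : S.Opens} (a : Γ(S, U)) (x : T ⟶ S) (h : ⊤ ≤ x ⁻¹ᵁ U)
    (ha : ⊤ ≤ x ⁻¹ᵁ (S.basicOpen a)) : IsUnit (evalAt x h a) := by
  have h1 := Scheme.basicOpen_appLE x ⊤ U h a
  rw [inf_eq_left.2 ha] at h1
  refine T.toRingedSpace.isUnit_of_isUnit_germ ⊤ _ fun y hy ↦ ?_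
  have hy' : y ∈ T.basicOpen (x.appLE U ⊤ h a) := by rw [h1]; exact hy
  exact (T.mem_basicOpen _ y hy).1 hy'

lemma exists_morphismRestrict_eq_comp {X X' C : Scheme.{u}} (f : X ⟶ C) (f' : X' ⟶ C) (W : C.Opens)
    (g : (f ⁻¹ᵁ W).toScheme ⟶ X') (hg : g ≫ f' = (f ⁻¹ᵁ W).ι ≫ f) :
    ∃ g' : (f ⁻¹ᵁ W).toScheme ⟶ (f' ⁻¹ᵁ W).toScheme, g' ≫ f' ∣_ W = f ∣_ W := by
  refine ⟨IsOpenImmersion.lift (f' ⁻¹ᵁ W).ι g ?_, ?_⟩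
  · rw [Scheme.Opens.range_ι]
    rintro _ ⟨x, rfl⟩
    change f' (g x) ∈ W
    rw [← Scheme.Hom.comp_apply, hg]
    exact x.2
  · rw [← cancel_mono W.ι, Category.assoc, morphismRestrict_ι, morphismRestrict_ι,
      IsOpenImmersion.lift_fac_assoc, hg]

namespace ConeGrading

variable {C S : Scheme.{u}} {π : C ⟶ S} [IsAffineHom π] (G : ConeGrading π)

lemma evalAt_comp_zeroSection (U : S.affineOpens) {T : Scheme.{u}} (s : T ⟶ S)
    (h : ⊤ ≤ s ⁻¹ᵁ U.1) (h' : ⊤ ≤ (s ≫ G.zeroSection) ⁻¹ᵁ (π ⁻¹ᵁ U.1)) :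
    evalAt (s ≫ G.zeroSection) h' = (evalAt s h).comp (G.zeroRing U) := by
  have e : U.1 ≤ G.zeroSection ⁻¹ᵁ (π ⁻¹ᵁ U.1) := by
    rw [← Scheme.Hom.comp_preimage, zeroSection_comp]
    exact le_rfl
  have h1 : G.zeroSection.appLE (π ⁻¹ᵁ U.1) U.1 e = CommRingCat.ofHom (G.zeroRing U) := by
    refine (relHom_appLE π (𝟙 S) G.zero_compat U e).trans ?_
    simp only [Scheme.Hom.id_app]
    exact Category.comp_id _
  have h2 := Scheme.Hom.appLE_comp_appLE s G.zeroSection (π ⁻¹ᵁ U.1) U.1 ⊤ e h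
  rw [h1] at h2
  exact congr(($h2).hom).symm

omit [IsAffineHom π] in
lemma app_zeroRing_of_mem (U : S.affineOpens) {f : Γ(C, π ⁻¹ᵁ U.1)} (hf : f ∈ G.piece U 0) :
    π.app U.1 (G.zeroRing U f) = f := by
  rw [app_zeroRing]
  exact DirectSum.decompose_of_mem_same _ hf

lemma le_preimage_zeroSection {V : S.Opens} {T : Scheme.{u}} {s : T ⟶ S} (h : ⊤ ≤ s ⁻¹ᵁ V) :
    ⊤ ≤ (s ≫ G.zeroSection) ⁻¹ᵁ (π ⁻¹ᵁ V) := by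
  rw [← Scheme.Hom.comp_preimage, Category.assoc, zeroSection_comp, Category.comp_id]
  exact h

end ConeGrading

/-! ### The group action as a graded coaction -/

section Coaction

open MvPolynomial

variable {k : Type u} [Field k] {ι : Type u} {C S : Scheme.{u}} {p : S ⟶ Spec (.of k)}
  {π : C ⟶ S} {σ : GaAction ι (π ≫ p)}

lemma GaAction.smul_comp (hinv : σ.act ≫ π = (𝔸(ι; C) ↘ C) ≫ π) {T : Scheme.{u}} (u : ι → Γ(T, ⊤))
    (x : T ⟶ C) : σ.smul u x ≫ π = x ≫ π := by
  rw [smul, Category.assoc, hinv, AffineSpace.homOfVector_over_assoc]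

lemma GaAction.stable_preimage (hinv : σ.act ≫ π = (𝔸(ι; C) ↘ C) ≫ π) (V : S.Opens) :
    σ.Stable (π ⁻¹ᵁ V) := by
  intro T u x h
  rw [← Scheme.Hom.comp_preimage, smul_comp hinv]
  exact h

lemma isGradedCoaction [IsAffineHom π] {G : ConeGrading π} {w : ℕ}
    (hsemi : IsSemidirect G σ w) (U : S.affineOpens)
    (hσ : σ.Stable (π ⁻¹ᵁ U.1)) [Fintype ι] :
    IsGradedCoaction (G.piece U) w (GaAction.coaction (affine_preimage π U) hσ) := by
  have hW := affine_preimage π U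
  have hι {B : Type u} [CommRing B] : Function.Injective (Scheme.ΓSpecIso (.of B)).inv.hom :=
    (Scheme.ΓSpecIso (.of B)).commRingCatIsoToRingEquiv.symm.injective
  have hev {B : Type u} [CommRing B] (φ : Γ(C, π ⁻¹ᵁ U.1) →+* B) (u : ι → B) :
      evalAt (σ.smul (fun i ↦ (Scheme.ΓSpecIso (.of B)).inv.hom (u i)) (specPoint hW φ))
        (hσ _ (le_specPoint_preimage hW φ)) = (Scheme.ΓSpecIso (.of B)).inv.hom.comp
          ((eval₂Hom φ u).comp (GaAction.coaction hW hσ)) := by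
    rw [GaAction.evalAt_smul hW hσ _ _ (le_specPoint_preimage hW φ), evalAt_specPoint]
    ext g
    simp only [RingHom.comp_apply, coe_eval₂Hom]
    exact (hom_eval₂ _ _ _ _).symm
  refine ⟨fun g ↦ ?_, fun {B} _ φ u v g ↦ ?_, fun {B} _ t φ u g ↦ ?_⟩
  · have h1 := hev (RingHom.id _) (fun _ ↦ 0)
    have h2 : σ.smul (fun i ↦ (Scheme.ΓSpecIso (.of Γ(C, π ⁻¹ᵁ U.1))).inv.hom 0)
        (specPoint hW (RingHom.id _)) = specPoint hW (RingHom.id _) := by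
      simp only [map_zero]
      exact σ.zero_smul _
    simp only [h2] at h1
    rw [evalAt_specPoint] at h1
    have h3 := hι congr($h1 g)
    simp only [RingHom.comp_apply, coe_eval₂Hom] at h3
    refine Eq.trans ?_ h3.symm
    have := eval₂_of_mul_eq_zero (RingHom.id Γ(C, π ⁻¹ᵁ U.1)) (fun _ : ι ↦ 0) (by simp)
      (GaAction.coaction hW hσ g)
    simpa using this.symm
  · have h1 := hev φ (u + v)
    set ιB := (Scheme.ΓSpecIso (.of B)).inv.hom
    have h2 : σ.smul (fun i ↦ ιB ((u + v) i)) (specPoint hW φ) =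
        σ.smul (fun i ↦ ιB (u i)) (σ.smul (fun i ↦ ιB (v i)) (specPoint hW φ)) := by
      rw [← σ.add_smul]
      congr 1
      ext i
      exact map_add ιB _ _
    simp only [h2] at h1
    rw [GaAction.evalAt_smul hW hσ _ _ (hσ _ (le_specPoint_preimage hW φ)), hev] at h1
    have h3 := congr($h1 g)
    simp only [RingHom.comp_apply, coe_eval₂Hom] at h3
    apply hι
    rw [← h3, hom_eval₂]
  · set ιB := (Scheme.ΓSpecIso (.of B)).inv.hom
    have hgm {T : Scheme.{u}} (t : Γ(T, ⊤)ˣ) {x : T ⟶ C} (h : ⊤ ≤ x ⁻¹ᵁ (π ⁻¹ᵁ U.1)) :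
        ⊤ ≤ G.gm t x ⁻¹ᵁ (π ⁻¹ᵁ U.1) := by
      rw [← Scheme.Hom.comp_preimage, G.gm_comp]
      exact h
    have hx := le_specPoint_preimage hW φ
    have h1 := hsemi _ (Units.map ιB.toMonoidHom t) (fun i ↦ ιB (u i)) (specPoint hW φ)
    have h2 := G.evalAt_gm U (Units.map ιB.toMonoidHom t) _ (hσ (fun i ↦ ιB (u i)) hx)
      (hgm _ (hσ _ hx))
    have h3 := GaAction.evalAt_smul hW hσ
      (fun i ↦ ((Units.map ιB.toMonoidHom t : Γ(Spec (.of B), ⊤)ˣ) : Γ(Spec (.of B), ⊤)) ^ w *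
        ιB (u i))
      _ (hgm (Units.map ιB.toMonoidHom t) hx) (hσ _ (hgm _ hx))
    simp only [h1] at h2
    rw [h2] at h3
    rw [hev, G.evalAt_gm U _ _ hx, evalAt_specPoint] at h3
    change twist _ _ (ιB (t : B)) = (eval₂Hom (twist _ _ (ιB (t : B)))
      (fun i ↦ ιB (t : B) ^ w * ιB (u i))).comp _ at h3
    rw [← comp_twist, ← comp_twist] at h3
    have h4 := congr($h3 g)
    simp only [RingHom.comp_apply, coe_eval₂Hom, ← map_pow, ← map_mul] at h4
    apply hι
    rw [hom_eval₂]
    exact h4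

end Coaction

/-! ### Derivatives along the zero section and slices -/

section Slice

open MvPolynomial

variable {k : Type u} [Field k] {ι : Type u} {C S : Scheme.{u}} {p : S ⟶ Spec (.of k)}
  {π : C ⟶ S} [IsAffineHom π] (G : ConeGrading π) {σ : GaAction ι (π ≫ p)} {U : S.affineOpens}
  (hσ : σ.Stable (π ⁻¹ᵁ U.1))

/-- The restriction to the zero section of the derivation of `Γ(C, π⁻¹ U)` given by the `l`-th
basis vector of the Lie algebra. -/
def derivAtZero (l : ι) (g : Γ(C, π ⁻¹ᵁ U.1)) : Γ(S, U.1) :=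
  G.zeroRing U (coeff (Finsupp.single l 1) (GaAction.coaction (affine_preimage π U) hσ g))

variable {G} {hσ}

lemma derivAtZero_add (l : ι) (g g' : Γ(C, π ⁻¹ᵁ U.1)) :
    derivAtZero G hσ l (g + g') = derivAtZero G hσ l g + derivAtZero G hσ l g' := by
  simp [derivAtZero]

variable [Fintype ι] {w : ℕ}

lemma derivAtZero_app_mul (hw : 0 < w) (hsemi : IsSemidirect G σ w) (l : ι) (a : Γ(S, U.1))
    (g : Γ(C, π ⁻¹ᵁ U.1)) :
    derivAtZero G hσ l (π.app U.1 a * g) = a * derivAtZero G hσ l g := by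
  unfold derivAtZero
  rw [map_mul, (isGradedCoaction hsemi U hσ).map_zero_mem hw (G.app_mem_zero U a),
    coeff_C_mul, map_mul, G.zeroRing_app]

/-- Linear coefficients of `ρ g` lower degree by `w`, and restriction to the zero section keeps only
degree `0`. -/
lemma derivAtZero_decompose (hsemi : IsSemidirect G σ w) (l : ι) (g : Γ(C, π ⁻¹ᵁ U.1)) :
    derivAtZero G hσ l (DirectSum.decompose (G.piece U) g w) = derivAtZero G hσ l g := by
  induction g using DirectSum.Decomposition.inductionOn (G.piece U) with
  | zero => simp
  | @homogeneous n g =>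
    rcases eq_or_ne n w with rfl | hn
    · rw [DirectSum.decompose_of_mem_same _ g.2]
    · unfold derivAtZero
      rw [DirectSum.decompose_of_mem_ne _ g.2 hn, map_zero, MvPolynomial.coeff_zero, map_zero]
      apply G.injective U
      rw [map_zero, G.app_zeroRing]
      exact ((isGradedCoaction hsemi U hσ).decompose_coeff g.2 _ (by simpa using hn.symm)).symm
  | add g g' hg hg' =>
    rw [DirectSum.decompose_add, DirectSum.add_apply, AddSubgroup.coe_add, derivAtZero_add, hg, hg',
      derivAtZero_add]

lemma app_derivAtZero (hsemi : IsSemidirect G σ w) (l : ι) {f : Γ(C, π ⁻¹ᵁ U.1)}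
    (hf : f ∈ G.piece U w) : π.app U.1 (derivAtZero G hσ l f) =
      coeff (Finsupp.single l 1) (GaAction.coaction (affine_preimage π U) hσ f) :=
  G.app_zeroRing_of_mem U ((isGradedCoaction hsemi U hσ).coeff_single_mem hf l)

/-- At `εξ` all products of coordinates vanish, so the coaction reduces to its constant and linear
terms. -/
lemma mem_stab_iff (hsemi : IsSemidirect G σ w) (z : Spec (.of k) ⟶ S) (h : ⊤ ≤ z ⁻¹ᵁ U.1) (ξ : ι → k) : ξ ∈ σ.stab (z ≫ G.zeroSection) ↔
      ∀ g, ∑ l, ξ l * pointHom z h (derivAtZero G hσ l g) = 0 := by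
  have hW := affine_preimage π U
  set x := GaAction.dualBase k ≫ z ≫ G.zeroSection
  have hx : ⊤ ≤ x ⁻¹ᵁ (π ⁻¹ᵁ U.1) := by
    have := G.le_preimage_zeroSection (s := GaAction.dualBase k ≫ z) (V := U.1)
      (fun y _ ↦ h (Set.mem_univ _))
    rwa [Category.assoc] at this
  set ιD := (Scheme.ΓSpecIso (.of (DualNumber k))).inv.hom
  have hιD : Function.Injective ιD :=
    (Scheme.ΓSpecIso (.of (DualNumber k))).commRingCatIsoToRingEquiv.symm.injective
  set φ : Γ(C, π ⁻¹ᵁ U.1) →+* DualNumber k :=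
    (algebraMap k (DualNumber k)).comp ((pointHom z h).comp (G.zeroRing U)) with hφ
  have hev : evalAt x hx = ιD.comp φ := by
    have h1 := evalAt_comp (GaAction.dualBase k) (z ≫ G.zeroSection)
      (G.le_preimage_zeroSection h) hx
    refine h1.trans ?_
    rw [G.evalAt_comp_zeroSection U z h, evalAt_eq_pointHom]
    have := Scheme.ΓSpecIso_inv_naturality (CommRingCat.ofHom (algebraMap k (DualNumber k)))
    ext g
    exact congr(($this).hom (pointHom z h (G.zeroRing U g))).symm
  have hsm := GaAction.evalAt_smul hW hσ (GaAction.dualVec ξ) x hx (hσ _ hx)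
  rw [hev] at hsm
  have hlin (g : Γ(C, π ⁻¹ᵁ U.1)) : evalAt (σ.smul (GaAction.dualVec ξ) x) (hσ _ hx) g =
      ιD (φ g + TrivSqZeroExt.inr (∑ l, ξ l * pointHom z h (derivAtZero G hσ l g))) := by
    rw [hsm, RingHom.comp_apply, coe_eval₂Hom]
    refine (hom_eval₂ _ φ ιD fun l ↦ (TrivSqZeroExt.inr (ξ l) : DualNumber k)).symm.trans ?_
    congr 1
    rw [eval₂_of_mul_eq_zero _ _ (fun i j ↦ TrivSqZeroExt.inr_mul_inr _ _ _),
      (isGradedCoaction hsemi U hσ).coeff_zero]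
    congr 1
    rw [TrivSqZeroExt.inr_sum]
    refine Finset.sum_congr rfl fun l _ ↦ ?_
    rw [hφ, RingHom.comp_apply, TrivSqZeroExt.algebraMap_eq_inl, TrivSqZeroExt.inr_mul_inl]
    simp [derivAtZero]
  constructor
  · intro hξ g
    have h1 : σ.smul (GaAction.dualVec ξ) x = x := hξ
    have h2 := hlin g
    simp only [h1] at h2
    rw [hev] at h2
    have h3 := hιD h2
    rw [left_eq_add] at h3
    exact TrivSqZeroExt.inr_injective (h3.trans (TrivSqZeroExt.inr_zero _).symm)
  · intro h0
    refine evalAt_injective hW (hσ _ hx) hx (RingHom.ext fun g ↦ ?_)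
    rw [hlin, h0, TrivSqZeroExt.inr_zero, add_zero, hev]
    rfl

variable (G hσ) in
/-- Functions of weight `w` on the cone over `U` that are dual, up to the factor `a`, to the basis
`β` of a complement of the stabilisers of the points of the zero section. -/
structure IsSlice {κ : Type u} [Fintype κ] [DecidableEq κ] (w : ℕ) (β : κ → ι → k)
    (f : κ → Γ(C, π ⁻¹ᵁ U.1)) (a : Γ(S, U.1)) : Prop where
  mem (j : κ) : f j ∈ G.piece U w
  pairing (i j : κ) :
    ∑ l, baseHom p U.1 (β i l) * derivAtZero G hσ l (f j) = if i = j then a else 0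
  relation (l : ι) (g : Γ(C, π ⁻¹ᵁ U.1)) : a * derivAtZero G hσ l g =
    ∑ j, derivAtZero G hσ l (f j) * ∑ i, baseHom p U.1 (β j i) * derivAtZero G hσ i g

lemma exists_isSlice [IsAlgClosed k] (hS : IsVariety p) (hw : 0 < w)
    (hsemi : IsSemidirect G σ w) {d : ℕ} (hstab : ∀ z : Spec (.of k) ⟶ S, z ≫ p = 𝟙 _ →
      Module.finrank k (σ.stab (z ≫ G.zeroSection)) = d) {s : S} (hs : s ∈ U.1) :
    ∃ (b : ℕ) (β : ULift.{u} (Fin b) → ι → k) (f : ULift.{u} (Fin b) → Γ(C, π ⁻¹ᵁ U.1))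
      (a : Γ(S, U.1)), IsSlice G hσ w β f a ∧ LinearIndependent k β ∧ s ∈ S.basicOpen a ∧
      ∀ z : Spec (.of k) ⟶ S, z ≫ p = 𝟙 _ → z ⁻¹ᵁ S.basicOpen a = ⊤ →
        IsCompl (Submodule.span k (Set.range β)) (σ.stab (z ≫ G.zeroSection)) := by
  have := hS.isIntegral
  have := hS.locallyOfFiniteType
  have hU : IsAffineOpen U.1 := U.2
  let _ : Algebra k Γ(S, U.1) := (baseHom p U.1).toAlgebra
  let _ : Algebra Γ(S, U.1) Γ(C, π ⁻¹ᵁ U.1) := (π.app U.1).hom.toAlgebra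
  have : Algebra.FiniteType k Γ(S, U.1) := baseHom_finiteType p hU
  have : Nonempty U.1 := ⟨⟨s, hs⟩⟩
  have : IsDomain Γ(S, U.1) := inferInstance
  let δ : ι → Γ(C, π ⁻¹ᵁ U.1) →ₗ[Γ(S, U.1)] Γ(S, U.1) := fun l ↦
    { toFun := derivAtZero G hσ l
      map_add' := derivAtZero_add l
      map_smul' := derivAtZero_app_mul hw hsemi l }
  have hstabAt (z : Spec (.of k) ⟶ S) (hz : z ≫ p = 𝟙 _) (h : ⊤ ≤ z ⁻¹ᵁ U.1)
      (ζ : Γ(S, U.1) →ₐ[k] k) (hζ : pointHom z h = ζ) :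
      stabAt δ ζ = σ.stab (z ≫ G.zeroSection) := by
    ext ξ
    rw [mem_stabAt, mem_stab_iff hsemi z h (hσ := hσ), hζ]
    rfl
  have hd (ζ : Γ(S, U.1) →ₐ[k] k) : Module.finrank k (stabAt δ ζ) = d := by
    have hz := specPoint_comp p hU (ζ : Γ(S, U.1) →+* k) ζ.commutes
    rw [hstabAt _ hz _ ζ (pointHom_specPoint hU _), hstab _ hz]
  -- The point `s` need not be closed. The construction is made at a closed specialisation of `s` in
  -- `U`; if `a` is nonzero there, it is nonzero at `s`.
  obtain ⟨m, hm, hle⟩ := Ideal.exists_le_maximal _ (hU.primeIdealOf ⟨s, hs⟩).isPrime.ne_top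
  obtain ⟨ζ₀, hζ₀⟩ := exists_algHom_of_isMaximal k m
  obtain ⟨b, β, f, a, hβ, ha, hpair, hcompl, hrel⟩ := exists_adapted_complement.{u} hd ζ₀
  refine ⟨b, β, fun j ↦ DirectSum.decompose (G.piece U) (f j) w, a,
    ⟨fun j ↦ SetLike.coe_mem _, fun i j ↦ ?_, fun l g ↦ ?_⟩, hβ, ?_, fun z hz hza ↦ ?_⟩
  · simp only [derivAtZero_decompose hsemi]
    exact (hpair i j).trans (by congr)
  · simp only [derivAtZero_decompose hsemi]
    exact hrel l g
  · have h1 : hU.primeIdealOf ⟨s, hs⟩ ∈ hU.fromSpec ⁻¹ᵁ S.basicOpen a := by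
      rw [hU.fromSpec_preimage_basicOpen]
      exact fun h ↦ ha ((hζ₀ a).2 (hle h))
    have h2 : hU.fromSpec (hU.primeIdealOf ⟨s, hs⟩) ∈ S.basicOpen a := h1
    rwa [hU.fromSpec_primeIdealOf] at h2
  · have hzU : ⊤ ≤ z ⁻¹ᵁ U.1 := hza.ge.trans (z.preimage_mono (S.basicOpen_le a))
    let ζ : Γ(S, U.1) →ₐ[k] k :=
      { pointHom z hzU with commutes' := pointHom_baseHom p z hzU hz }
    rw [← hstabAt z hz hzU ζ rfl]
    refine hcompl ζ ?_
    exact ((isUnit_evalAt a z hzU hza.ge).map (Scheme.ΓSpecIso (.of k)).hom.hom).ne_zero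

variable {κ : Type u} [Fintype κ] [DecidableEq κ] {β : κ → ι → k}
  {f : κ → Γ(C, π ⁻¹ᵁ U.1)} {a : Γ(S, U.1)}

namespace IsSlice

/-- The affine transformation law of functions of weight `w`, combined with the pairing: along `U'`
the function `f j` only moves with the `j`-th coordinate. -/
lemma evalAt_smul_lin (hsl : IsSlice G hσ w β f a) (hw : 0 < w) (hsemi : IsSemidirect G σ w)
    {T : Scheme.{u}} (x : T ⟶ C) (h : ⊤ ≤ x ⁻¹ᵁ (π ⁻¹ᵁ U.1)) (c : κ → Γ(T, ⊤))
    (h' : ⊤ ≤ σ.smul (GaAction.lin (x ≫ π ≫ p) β c) x ⁻¹ᵁ (π ⁻¹ᵁ U.1)) (j : κ) :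
    evalAt (σ.smul (GaAction.lin (x ≫ π ≫ p) β c) x) h' (f j) =
      evalAt x h (f j) + c j * evalAt x h (π.app U.1 a) := by
  rw [GaAction.evalAt_smul (affine_preimage π U) hσ _ x h, RingHom.comp_apply, coe_eval₂Hom,
    (isGradedCoaction hsemi U hσ).eval₂_of_mem hw _ _ (hsl.mem j)]
  congr 1
  have hsc (c : k) : scalar (x ≫ π ≫ p) c = evalAt x h (π.app U.1 (baseHom p U.1 c)) := by
    rw [evalAt_app π x h h]
    exact ((evalAt_baseHom p (x ≫ π) h c).trans (by rw [Category.assoc])).symm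
  simp only [GaAction.lin, Finset.sum_mul, hsc, ← app_derivAtZero hsemi _ (hsl.mem j)]
  rw [Finset.sum_comm]
  have h1 (i : κ) : ∑ l, evalAt x h (π.app U.1 (baseHom p U.1 (β i l))) * c i *
      evalAt x h (π.app U.1 (derivAtZero G hσ l (f j))) =
      c i * evalAt x h (π.app U.1 (if i = j then a else 0)) := by
    rw [← hsl.pairing i j, map_sum, map_sum, Finset.mul_sum]
    refine Finset.sum_congr rfl fun l _ ↦ ?_
    rw [map_mul, map_mul]
    ring
  simp only [h1]
  rw [Finset.sum_eq_single j]
  · simp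
  · intro i _ hi
    simp [hi]
  · simp

/-- The coordinates given to `lin` are those of the projection of `u` to `𝔳` along the stabilisers.
As `relation` is an identity of functions on `U`, the argument covers arbitrary, possibly
non-reduced, `T`. -/
lemma smul_eq_smul_lin [CharZero k] (hsl : IsSlice G hσ w β f a) (hsemi : IsSemidirect G σ w)
    {T : Scheme.{u}} (s : T ⟶ S) (h : ⊤ ≤ s ⁻¹ᵁ U.1) (u : ι → Γ(T, ⊤)) (a' : Γ(T, ⊤))
    (ha : evalAt s h a * a' = 1) :
    σ.smul (GaAction.lin (s ≫ p) β
      fun j ↦ a' * ∑ l, u l * evalAt s h (derivAtZero G hσ l (f j))) (s ≫ G.zeroSection) =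
    σ.smul u (s ≫ G.zeroSection) := by
  set c : κ → Γ(T, ⊤) := fun j ↦ a' * ∑ l, u l * evalAt s h (derivAtZero G hσ l (f j)) with hc
  set v := GaAction.lin (s ≫ p) β c with hv
  set x := s ≫ G.zeroSection
  have hx : ⊤ ≤ x ⁻¹ᵁ (π ⁻¹ᵁ U.1) := G.le_preimage_zeroSection h
  have := isAddTorsionFree_of_scalar (s ≫ p)
  suffices hfix : σ.smul (u - v) x = x by
    -- It remains to see that `u - v` fixes `x`; by characteristic zero it is enough that all
    -- derivatives along `u - v` vanish at `x`.
    rw [show u = v + (u - v) by simp, σ.add_smul, hfix]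
  refine evalAt_injective (affine_preimage π U) (hσ _ hx) hx ?_
  rw [GaAction.evalAt_smul (affine_preimage π U) hσ _ x hx]
  ext g
  refine (isGradedCoaction hsemi U hσ).eval₂_eq_of_linear_eq_zero _ _ (fun g ↦ ?_) g
  simp only [G.evalAt_comp_zeroSection U s h hx, x, RingHom.comp_apply]
  change ∑ l, (u l - v l) * evalAt s h (derivAtZero G hσ l g) = 0
  have h1 (l : ι) : evalAt s h (derivAtZero G hσ l g) =
      ∑ j, a' * (evalAt s h (derivAtZero G hσ l (f j)) *
        ∑ i, evalAt s h (baseHom p U.1 (β j i)) * evalAt s h (derivAtZero G hσ i g)) := by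
    have := congrArg (evalAt s h) (hsl.relation l g)
    simp only [map_mul, map_sum] at this
    rw [← Finset.mul_sum, ← this, ← mul_assoc, mul_comm a', ha, one_mul]
  have h2 : ∑ l, u l * evalAt s h (derivAtZero G hσ l g) =
      ∑ j, c j * ∑ i, evalAt s h (baseHom p U.1 (β j i)) * evalAt s h (derivAtZero G hσ i g) := by
    conv_lhs => enter [2, l]; rw [h1, Finset.mul_sum]
    rw [Finset.sum_comm]
    refine Finset.sum_congr rfl fun j _ ↦ ?_
    change _ = (a' * _) * _
    rw [mul_assoc, Finset.sum_mul, Finset.mul_sum]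
    refine Finset.sum_congr rfl fun l _ ↦ ?_
    ring
  have h3 : ∑ l, v l * evalAt s h (derivAtZero G hσ l g) =
      ∑ j, c j * ∑ i, evalAt s h (baseHom p U.1 (β j i)) * evalAt s h (derivAtZero G hσ i g) := by
    simp only [hv, GaAction.lin, Finset.sum_mul, ← evalAt_baseHom p s h]
    rw [Finset.sum_comm]
    refine Finset.sum_congr rfl fun j _ ↦ ?_
    rw [Finset.mul_sum]
    refine Finset.sum_congr rfl fun l _ ↦ ?_
    ring
  simp only [sub_mul, Finset.sum_sub_distrib, h2, h3, sub_self]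

end IsSlice

end Slice

lemma evalAt_congr {C T : Scheme.{u}} {W : C.Opens} {x x' : T ⟶ C} (e : x = x')
    (h : ⊤ ≤ x ⁻¹ᵁ W) (h' : ⊤ ≤ x' ⁻¹ᵁ W) (b : Γ(C, W)) : evalAt x h b = evalAt x' h' b := by
  subst e
  rfl

/-! ### The sweep morphisms on points -/

namespace GaAction

variable {k : Type u} [Field k] {ι : Type u} {C : Scheme.{u}} {p : C ⟶ Spec (.of k)}
  (σ : GaAction ι p)

lemma comp_sweep {Z T : Scheme.{u}} (i : Z ⟶ C) (y : T ⟶ 𝔸(ι; Z)) :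
    y ≫ σ.sweep i =
      σ.smul (fun l ↦ y.appTop (AffineSpace.coord Z l)) ((y ≫ (𝔸(ι; Z) ↘ Z)) ≫ i) := by
  rw [sweep, smul, ← Category.assoc]
  congr 1
  refine AffineSpace.hom_ext ?_ fun l ↦ ?_
  · simp
  · rw [Scheme.Hom.comp_appTop, CommRingCat.comp_apply, AffineSpace.map_appTop_coord,
      AffineSpace.homOfVector_appTop_coord]

lemma comp_lin {κ : Type u} [Fintype κ] {X Y : Scheme.{u}} (g : X ⟶ Y) (q : Y ⟶ Spec (.of k))
    (β : κ → ι → k) (c : κ → Γ(Y, ⊤)) (l : ι) :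
    g.appTop (lin q β c l) = lin (g ≫ q) β (fun j ↦ g.appTop (c j)) l := by
  simp only [lin, map_sum, map_mul, comp_scalar]

lemma comp_subSweep {κ : Type u} [Fintype κ] (β : κ → ι → k) {Z T : Scheme.{u}} (i : Z ⟶ C)
    (y : T ⟶ 𝔸(κ; Z)) : y ≫ σ.subSweep β i =
      σ.smul (lin ((y ≫ (𝔸(κ; Z) ↘ Z)) ≫ i ≫ p) β
        fun j ↦ y.appTop (AffineSpace.coord Z j)) ((y ≫ (𝔸(κ; Z) ↘ Z)) ≫ i) := by
  rw [subSweep, ← Category.assoc, comp_sweep]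
  congr 1
  · ext l
    rw [Scheme.Hom.comp_appTop, CommRingCat.comp_apply, subgroupHom,
      AffineSpace.homOfVector_appTop_coord, comp_lin]
    simp only [Category.assoc]
  · rw [subgroupHom, Category.assoc y, AffineSpace.homOfVector_over]

end GaAction

/-! ### Freeness, closed immersion and comparison of the two sweeps -/

section Local

variable {k : Type u} [Field k] {ι : Type u} {C S : Scheme.{u}} {p : S ⟶ Spec (.of k)}
  {π : C ⟶ S} [IsAffineHom π] {G : ConeGrading π} {σ : GaAction ι (π ≫ p)} {U : S.affineOpens}
  {hσ : σ.Stable (π ⁻¹ᵁ U.1)} [Fintype ι] {w : ℕ} {κ : Type u} [Fintype κ] [DecidableEq κ]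
  {β : κ → ι → k} {f : κ → Γ(C, π ⁻¹ᵁ U.1)} {a : Γ(S, U.1)}

omit [Fintype ι] in
lemma sweep_zeroSection_comp (hinv : σ.act ≫ π = (𝔸(ι; C) ↘ C) ≫ π) :
    σ.sweep G.zeroSection ≫ π = 𝔸(ι; S) ↘ S := by
  rw [← Category.id_comp (σ.sweep _), GaAction.comp_sweep, GaAction.smul_comp hinv,
    Category.assoc, G.zeroSection_comp, Category.id_comp, Category.comp_id]

omit [Fintype ι] [DecidableEq κ] in
lemma subSweep_zeroSection_comp (hinv : σ.act ≫ π = (𝔸(ι; C) ↘ C) ≫ π) :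
    σ.subSweep β G.zeroSection ≫ π = 𝔸(κ; S) ↘ S := by
  rw [← Category.id_comp (σ.subSweep _ _), GaAction.comp_subSweep, GaAction.smul_comp hinv,
    Category.assoc, G.zeroSection_comp, Category.id_comp, Category.comp_id]

namespace IsSlice

variable (hsl : IsSlice G hσ w β f a) (hw : 0 < w) (hsemi : IsSemidirect G σ w)
include hsl hw hsemi

lemma actsFreelyOn : σ.ActsFreelyOn β (π ⁻¹ᵁ S.basicOpen a) := by
  intro T x hx c hc
  have h : ⊤ ≤ x ⁻¹ᵁ (π ⁻¹ᵁ U.1) :=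
    hx.ge.trans (x.preimage_mono (π.preimage_mono (S.basicOpen_le a)))
  have hu : IsUnit (evalAt x h (π.app U.1 a)) := by
    rw [evalAt_app π x h h]
    exact isUnit_evalAt a (x ≫ π) h hx.ge
  have hc0 : c = 0 := by
    ext j
    have h1 := hsl.evalAt_smul_lin hw hsemi x h c (hσ _ h) j
    simp only [hc] at h1
    rw [left_eq_add] at h1
    exact hu.mul_left_eq_zero.1 h1
  ext l
  simp [hc0, GaAction.lin]

/-- Since `f j` has positive weight, it vanishes on the zero section, and the transformation law
leaves only `c_j a`. -/
lemma evalAt_comp_subSweep (hinv : σ.act ≫ π = (𝔸(ι; C) ↘ C) ≫ π) {T : Scheme.{u}}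
    (y : T ⟶ 𝔸(κ; S)) (h : ⊤ ≤ (y ≫ σ.subSweep β G.zeroSection) ⁻¹ᵁ (π ⁻¹ᵁ U.1)) (j : κ) :
    evalAt (y ≫ σ.subSweep β G.zeroSection) h (f j) = y.appTop (AffineSpace.coord S j) *
      evalAt (y ≫ σ.subSweep β G.zeroSection) h (π.app U.1 a) := by
  set s := y ≫ (𝔸(κ; S) ↘ S)
  have hsπ : (y ≫ σ.subSweep β G.zeroSection) ≫ π = s := by
    rw [Category.assoc, subSweep_zeroSection_comp hinv]
  have hs : ⊤ ≤ s ⁻¹ᵁ U.1 := by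
    rw [← hsπ]
    exact h
  have hz := G.le_preimage_zeroSection hs
  have hsz : (s ≫ G.zeroSection) ≫ π = s := by
    rw [Category.assoc, G.zeroSection_comp, Category.comp_id]
  have e1 := hsl.evalAt_smul_lin hw hsemi _ hz (fun j ↦ y.appTop (AffineSpace.coord S j))
    (hσ _ hz) j
  rw [G.evalAt_comp_zeroSection U _ hs hz, RingHom.comp_apply, G.zeroRing_of_mem U hw (hsl.mem j),
    map_zero, zero_add, ← G.evalAt_comp_zeroSection U _ hs hz] at e1
  have e2 : y ≫ σ.subSweep β G.zeroSection = σ.smul (GaAction.lin ((s ≫ G.zeroSection) ≫ π ≫ p) β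
      fun j ↦ y.appTop (AffineSpace.coord S j)) (s ≫ G.zeroSection) := by
    rw [GaAction.comp_subSweep]
    simp only [s, Category.assoc]
  rw [evalAt_congr e2 h (hσ _ hz), e1, evalAt_app π _ hz hz, evalAt_app π _ h h]
  exact congrArg (_ * ·) (evalAt_congr (hsz.trans hsπ.symm) _ _ _)

lemma isClosedImmersion_subSweep (hinv : σ.act ≫ π = (𝔸(ι; C) ↘ C) ≫ π) :
    IsClosedImmersion (σ.subSweep β G.zeroSection ∣_ (π ⁻¹ᵁ S.basicOpen a)) := by
  set W := π ⁻¹ᵁ S.basicOpen a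
  set φ := σ.subSweep β G.zeroSection
  have hWι : ⊤ ≤ W.ι ⁻¹ᵁ W := W.ι_preimage_self.ge
  have h : ⊤ ≤ W.ι ⁻¹ᵁ (π ⁻¹ᵁ U.1) :=
    hWι.trans (W.ι.preimage_mono (π.preimage_mono (S.basicOpen_le a)))
  obtain ⟨a', ha'⟩ : ∃ a', evalAt W.ι h (π.app U.1 a) * a' = 1 := by
    refine IsUnit.exists_right_inv ?_
    rw [evalAt_app π W.ι h h]
    exact isUnit_evalAt a (W.ι ≫ π) h hWι
  let ρ : W.toScheme ⟶ 𝔸(κ; S) :=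
    AffineSpace.homOfVector (W.ι ≫ π) fun j ↦ evalAt W.ι h (f j) * a'
  have hρ : Set.range ρ ⊆ Set.range (φ ⁻¹ᵁ W).ι := by
    rw [Scheme.Opens.range_ι]
    rintro _ ⟨x, rfl⟩
    change (φ ≫ π) (ρ x) ∈ S.basicOpen a
    rw [subSweep_zeroSection_comp hinv, ← Scheme.Hom.comp_apply, AffineSpace.homOfVector_over]
    exact x.2
  let r := IsOpenImmersion.lift (φ ⁻¹ᵁ W).ι ρ hρ
  have hr : φ ∣_ W ≫ r = 𝟙 _ := by
    rw [← cancel_mono (φ ⁻¹ᵁ W).ι, Category.assoc, IsOpenImmersion.lift_fac, Category.id_comp]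
    set y := (φ ⁻¹ᵁ W).ι
    have hy : φ ∣_ W ≫ W.ι = y ≫ φ := morphismRestrict_ι _ _
    refine AffineSpace.hom_ext ?_ fun j ↦ ?_
    · rw [Category.assoc, AffineSpace.homOfVector_over, reassoc_of% hy,
        subSweep_zeroSection_comp hinv]
    · rw [Scheme.Hom.comp_appTop, CommRingCat.comp_apply, AffineSpace.homOfVector_appTop_coord,
        map_mul]
      set g := (φ ∣_ W).appTop
      have hg (b : Γ(C, π ⁻¹ᵁ U.1)) (h' : ⊤ ≤ (φ ∣_ W ≫ W.ι) ⁻¹ᵁ (π ⁻¹ᵁ U.1)) :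
          g (evalAt W.ι h b) = evalAt (φ ∣_ W ≫ W.ι) h' b :=
        congr($(evalAt_comp (φ ∣_ W) W.ι h h') b).symm
      have h' : ⊤ ≤ (φ ∣_ W ≫ W.ι) ⁻¹ᵁ (π ⁻¹ᵁ U.1) := fun x _ ↦ h (Set.mem_univ _)
      have h'' : ⊤ ≤ (y ≫ φ) ⁻¹ᵁ (π ⁻¹ᵁ U.1) := hy ▸ h'
      have e2 : g (evalAt W.ι h (f j)) = y.appTop (AffineSpace.coord S j) *
          g (evalAt W.ι h (π.app U.1 a)) := by
        rw [hg _ h', hg _ h', evalAt_congr hy h' h'', evalAt_congr hy h' h'']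
        exact hsl.evalAt_comp_subSweep hw hsemi hinv y h'' j
      have e3 : g (evalAt W.ι h (π.app U.1 a)) * g a' = 1 := by
        rw [← map_mul, ha', map_one]
      rw [e2, mul_assoc, e3, mul_one]
  -- As `W` is affine, `r` is separated, and a section of a separated morphism is a closed
  -- immersion.
  have : IsAffine W := affine_preimage π ⟨S.basicOpen a, U.2.basicOpen a⟩
  have : IsClosedImmersion (φ ∣_ W ≫ r) := by rw [hr]; infer_instance
  exact IsClosedImmersion.of_comp (φ ∣_ W) r

omit hw in
lemma exists_factor_sweep [CharZero k] (hinv : σ.act ≫ π = (𝔸(ι; C) ↘ C) ≫ π) :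
    ∃ g, g ≫ σ.subSweep β G.zeroSection ∣_ (π ⁻¹ᵁ S.basicOpen a) =
      σ.sweep G.zeroSection ∣_ (π ⁻¹ᵁ S.basicOpen a) := by
  set W := π ⁻¹ᵁ S.basicOpen a
  set y := (σ.sweep G.zeroSection ⁻¹ᵁ W).ι
  set s := y ≫ (𝔸(ι; S) ↘ S)
  have hs : ⊤ ≤ s ⁻¹ᵁ S.basicOpen a := by
    change ⊤ ≤ (y ≫ _) ⁻¹ᵁ _
    rw [← sweep_zeroSection_comp (G := G) hinv]
    exact (Scheme.Opens.ι_preimage_self _).ge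
  have hsU : ⊤ ≤ s ⁻¹ᵁ U.1 := hs.trans (s.preimage_mono (S.basicOpen_le a))
  obtain ⟨a', ha'⟩ := (isUnit_evalAt a s hsU hs).exists_right_inv
  have h1 := hsl.smul_eq_smul_lin hsemi s hsU (fun l ↦ y.appTop (AffineSpace.coord S l)) a' ha'
  refine exists_morphismRestrict_eq_comp _ _ _ (AffineSpace.homOfVector s
    fun j ↦ a' * ∑ l, y.appTop (AffineSpace.coord S l) *
      evalAt s hsU (derivAtZero G hσ l (f j))) ?_
  rw [GaAction.comp_subSweep, GaAction.comp_sweep]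
  refine Eq.trans ?_ h1
  simp only [AffineSpace.homOfVector_over, AffineSpace.homOfVector_appTop_coord]
  congr 2
  rw [Category.assoc, ← Category.assoc G.zeroSection, G.zeroSection_comp, Category.id_comp]
  exact (Category.assoc _ _ _).symm

end IsSlice

omit [Fintype ι] [DecidableEq κ] in
lemma exists_factor_subSweep (W : C.Opens) :
    ∃ g, g ≫ σ.sweep G.zeroSection ∣_ W = σ.subSweep β G.zeroSection ∣_ W :=
  exists_morphismRestrict_eq_comp _ _ _
    ((σ.subSweep β G.zeroSection ⁻¹ᵁ W).ι ≫ GaAction.subgroupHom (G.zeroSection ≫ π ≫ p) β)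
    (by rw [GaAction.subSweep, Category.assoc])

end Local

/-! ### Ranges and their closedness, locally on the target -/

lemma range_subset_of_comp {X Y Z : Scheme.{u}} {g : X ⟶ Y} {f : Y ⟶ Z} {f' : X ⟶ Z}
    (h : g ≫ f = f') : Set.range f' ⊆ Set.range f := by
  rintro _ ⟨x, rfl⟩
  exact ⟨g x, by rw [← h, Scheme.Hom.comp_apply]⟩

lemma isClosed_range_of_forall_exists {X Y : Scheme.{u}} (f : X ⟶ Y)
    (h : ∀ y : Y, ∃ W : Y.Opens, y ∈ W ∧ IsClosed (Set.range (f ∣_ W))) :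
    IsClosed (Set.range f) := by
  choose W hyW hW using h
  have hcov : TopologicalSpace.IsOpenCover W :=
    eq_top_iff.2 fun y _ ↦ TopologicalSpace.Opens.mem_iSup.2 ⟨y, hyW y⟩
  rw [hcov.isClosed_iff_coe_preimage]
  intro y
  refine (congrArg IsClosed ?_).mpr (hW y)
  ext x
  constructor
  · rintro ⟨t, ht⟩
    have ht' : t ∈ f ⁻¹ᵁ W y := by
      change f t ∈ W y
      rw [ht]
      exact x.2
    exact ⟨⟨t, ht'⟩, Subtype.ext ((morphismRestrict_base_coe f (W y) ⟨t, ht'⟩).trans ht)⟩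
  · rintro ⟨t, rfl⟩
    exact ⟨t.1, (morphismRestrict_base_coe f (W y) t).symm⟩

end GradedAdditive
end

open GradedAdditive
theorem lemma5p1 {k : Type u} [Field k] [IsAlgClosed k] [CharZero k]
    {C S : Scheme.{u}} (p : S ⟶ Spec (.of k)) (π : C ⟶ S) [IsAffineHom π]
    (hS : IsVariety p) (hC : IsVariety (π ≫ p)) (G : ConeGrading π)
    (r w : ℕ) (hr : 0 < r) (hw : 0 < w)
    (σ : GaAction (ULift.{u} (Fin r)) (π ≫ p))
    (hinv : σ.act ≫ π = (𝔸(ULift.{u} (Fin r); C) ↘ C) ≫ π)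
    (hsemi : IsSemidirect G σ w)
    (hstab : ∀ z : Spec (.of k) ⟶ S, z ≫ p = 𝟙 _ →
      Module.finrank k (σ.stab (z ≫ G.zeroSection)) = minStabDim G σ) :
    IsClosed (Set.range (σ.sweep G.zeroSection)) ∧
    ∀ s : S, ∃ V : S.affineOpens, s ∈ V.1 ∧
      ∃ (b : ℕ) (β : ULift.{u} (Fin b) → (ULift.{u} (Fin r) → k)),
        LinearIndependent k β ∧
        (∀ z : Spec (.of k) ⟶ S, z ≫ p = 𝟙 _ → z ⁻¹ᵁ V.1 = ⊤ →
          IsCompl (Submodule.span k (Set.range β)) (σ.stab (z ≫ G.zeroSection))) ∧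
        σ.ActsFreelyOn β (π ⁻¹ᵁ V.1) ∧
        Set.range (σ.sweep G.zeroSection ∣_ (π ⁻¹ᵁ V.1)) =
          Set.range (σ.subSweep β G.zeroSection ∣_ (π ⁻¹ᵁ V.1)) ∧
        Set.range (σ.sweep G.zeroSection ∣_ (π ⁻¹ᵁ V.1)) =
          ((σ.subSweep β G.zeroSection ∣_ (π ⁻¹ᵁ V.1)).ker.support : Set _) ∧
        (σ.sweep G.zeroSection ∣_ (π ⁻¹ᵁ V.1)).ker =
          (σ.subSweep β G.zeroSection ∣_ (π ⁻¹ᵁ V.1)).ker := by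
  have hW (V : S.Opens) : σ.Stable (π ⁻¹ᵁ V) := GaAction.stable_preimage hinv V
  -- Closedness is local on `C`, and the sets `π⁻¹ V` cover it; so the first claim follows from the
  -- second, where the image is the support of a kernel.
  refine (and_iff_right_of_imp fun hlocal ↦ ?_).2 fun s ↦ ?_
  · refine isClosed_range_of_forall_exists _ fun y ↦ ?_
    obtain ⟨V, hV, b, β, -, -, -, -, h, -⟩ := hlocal (π y)
    refine ⟨π ⁻¹ᵁ V.1, hV, ?_⟩
    rw [h]
    exact TopologicalSpace.Closeds.isClosed _
  · obtain ⟨_, ⟨U, hU, rfl⟩, hsU, -⟩ :=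
      S.isBasis_affineOpens.exists_subset_of_mem_open (Set.mem_univ s) isOpen_univ
    obtain ⟨b, β, f, a, hsl, hβ, hsa, hcompl⟩ :=
      exists_isSlice (U := ⟨U, hU⟩) (hσ := hW U) hS hw hsemi hstab hsU
    obtain ⟨g, hg⟩ := hsl.exists_factor_sweep hsemi hinv
    obtain ⟨g', hg'⟩ := exists_factor_subSweep (G := G) (σ := σ) (β := β) (π ⁻¹ᵁ S.basicOpen a)
    have := hsl.isClosedImmersion_subSweep hw hsemi hinv
    have hrange := (range_subset_of_comp hg).antisymm (range_subset_of_comp hg')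
    refine ⟨⟨S.basicOpen a, hU.basicOpen a⟩, hsa, b, β, hβ, hcompl,
      hsl.actsFreelyOn hw hsemi, hrange, ?_, le_antisymm ?_ ?_⟩
    -- The support of the kernel is the closure of the image, already closed for a closed immersion.
    · rw [hrange, Scheme.Hom.support_ker,
        (Scheme.Hom.isClosedEmbedding _).isClosed_range.closure_eq]
    · rw [← hg']
      exact Scheme.Hom.le_ker_comp _ _
    · rw [← hg]
      exact Scheme.Hom.le_ker_comp _ _
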